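/- Let $(S,A,p,r,\gamma)$ be a Markov decision process with finite non-empty state set $S$ and action set $A$, transition probabilities $p^j_{ia}$, real rewards $r^j_{ia}$ and discount factor $0\le\gamma<1$. Put $r(i,a)=\sum_j p^j_{ia}r^j_{ia}$, $\mathcal M Q(i)=\max_{b\in A}Q(i,b)$, $w^*=\min_{i,a}\frac1{1-\gamma p^i_{ia}}$, and for $w\in\mathbb R$, $Q\in\mathbb R^{S\times A}$, $$(U_wQ)(i,a)=w\Big(r(i,a)+\gamma\sum_{j\in S}p^j_{ia}\,\mathcal M Q(j)\Big)+(1-w)\,\mathcal M Q(i).$$ Model-free double SOR Q-learning (MF-DSORQL) runs as follows on a probability space. At iteration $n=0,1,2,\dots$ the agent is in state $i_n$ and chooses an action $a_n$, possibly depending on the past and on additional randomness; then, conditionally on the information $\mathcal G_n$ available at this moment (which determines the initial tables $Q^A_0,Q^B_0$, the states and actions up to $(i_n,a_n)$, the earlier coin tosses, and the step sizes up to $\beta_n$), the next state $i_{n+1}$ has law $p^{\,\cdot}_{i_na_n}$ and, independently of it, a fair coin decides whether $Q^A$ or $Q^B$ is updated. Fix a measurable rule that assigns to each vector $q\in\mathbb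 R^A$ an element $\arg\max q$ of its set of maximizers. If $Q^A$ is updated, then with $b^*=\arg\max_bQ^A_n(i_{n+1},b)$ and $c^*=\arg\max_cQ^A_n(i_n,c)$, $$Q^A_{n+1}(i_n,a_n)=(1-\beta_n(i_n,a_n))Q^A_n(i_n,a_n)+\beta_n(i_n,a_n)\Big(w_n\big(r^{i_{n+1}}_{i_na_n}+\gamma Q^B_n(i_{n+1},b^*)\big)+(1-w_n)Q^B_n(i_n,c^*)\Big).$$ If $Q^B$ is updated, then with $d^*=\arg\max_dQ^C_n(i_{n+1},d)$ and $e^*=\arg\max_eQ^C_n(i_n,e)$, $$Q^B_{n+1}(i_n,a_n)=(1-\beta_n(i_n,a_n))Q^B_n(i_n,a_n)+\beta_n(i_n,a_n)\Big(w_n\big(r^{i_{n+1}}_{i_na_n}+\gamma Q^A_n(i_{n+1},d^*)\big)+(1-w_n)Q^A_n(i_n,e^*)\Big).$$ Here $C\in\{A,B\}$ is fixed once and for all, and both choices are allowed. All other entries of the tables stay unchanged. The relaxation parameters are $w_0\in[1,\frac1{1-\gamma}]$ and $$w_{n+1}=w_n+\alpha(n)\Big(\frac1{1-\gamma\min_{i,a}\widetilde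 P_n(i,a)}-w_n\Big),\qquad n\ge 0,$$ where $\alpha(n)\in[0,1]$ are deterministic with $\sum_n\alpha(n)=\infty$ and $\sum_n\alpha(n)^2<\infty$, and $\widetilde P_n(i,a)$ is the empirical self-loop frequency: the number of $k<n$ with $(i_k,a_k,i_{k+1})=(i,a,i)$ divided by the number of $k<n$ with $(i_k,a_k)=(i,a)$ (and $0$ if the latter number is $0$). Suppose that, with probability one, - both tables are bounded: $\sup_{n,i,a}|Q^A_n(i,a)|<\infty$ and $\sup_{n,i,a}|Q^B_n(i,a)|<\infty$; - every pair $(i,a)\in S\times A$ is sampled infinitely often; - $0\le\beta_n(i,a)\le1$ for all $n,i,a$, and for every $(i,a)$ one has $\sum\beta_n(i,a)=\infty$ and $\sum\beta_n(i,a)^2<\infty$, the sums being over the iterations $n$ with $(i_n,a_n)=(i,a)$. Then $U_{w^*}$ has exactly one fixed point $Q^*_{w^*}$, and with probability one $Q^A_n\to Q^*_{w^*}$ and $Q^B_n\to Q^*_{w^*}$ as $n\to\infty$. -/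

import Mathlib

open MeasureTheory Filter Topology

/-- A finite Markov decision process with states `S`, actions `A`: transition probabilities
`p i a j`, rewards `r i a j` and a discount factor `0 ≤ γ < 1`. -/
structure MDP (S A : Type*) [Fintype S] where
  p : S → A → S → ℝ
  p_nonneg : ∀ i a j, 0 ≤ p i a j
  p_sum : ∀ i a, ∑ j, p i a j = 1
  r : S → A → S → ℝ
  γ : ℝ
  γ_nonneg : 0 ≤ γ
  γ_lt_one : γ < 1

/-- `maxOp Q i = max_b Q(i, b)`. -/
noncomputable def maxOp {S A : Type*} [Fintype A] [Nonempty A] (Q : S → A → ℝ) (i : S) : ℝ :=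
  Finset.univ.sup' Finset.univ_nonempty (fun b => Q i b)

namespace MDP

variable {S A : Type*} [Fintype S] [Fintype A] [Nonempty S] [Nonempty A]

/-- The expected one-step reward `r(i, a)`. -/
noncomputable def meanReward (M : MDP S A) (i : S) (a : A) : ℝ :=
  ∑ j, M.p i a j * M.r i a j

/-- The modified Bellman operator `U_w`. -/
noncomputable def sorOp (M : MDP S A) (w : ℝ) (Q : S → A → ℝ) : S → A → ℝ := fun i a =>
  w * (M.meanReward i a + M.γ * ∑ j, M.p i a j * maxOp Q j) + (1 - w) * maxOp Q i

/-- `w* = min_{i,a} 1 / (1 - γ p(i | i, a))`. -/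
noncomputable def wStar (M : MDP S A) : ℝ :=
  Finset.univ.inf' Finset.univ_nonempty
    (fun x : S × A => 1 / (1 - M.γ * M.p x.1 x.2 x.1))

end MDP

section Paths

/-! Quantities computed from one sample path `st 0, ac 0, st 1, ac 1, …`; iteration `k` takes
action `ac k` in state `st k` and observes the next state `st (k + 1)`. -/

variable {S A : Type*} [DecidableEq S] [DecidableEq A]

/-- Number of the first `n` iterations in which the pair `(i, a)` is sampled. -/
def visits (st : ℕ → S) (ac : ℕ → A) (n : ℕ) (i : S) (a : A) : ℕ :=
  ((Finset.range n).filter (fun k => st k = i ∧ ac k = a)).card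

/-- Number of the first `n` iterations in which `(i, a)` is sampled and the next state is `j`. -/
def transitions (st : ℕ → S) (ac : ℕ → A) (n : ℕ) (i : S) (a : A) (j : S) : ℕ :=
  ((Finset.range n).filter (fun k => st k = i ∧ ac k = a ∧ st (k + 1) = j)).card

/-- Empirical probability, after `n` iterations, of moving from `i` to `j` under `a`
(it is `0` as long as `(i, a)` has not been sampled). -/
noncomputable def empProb (st : ℕ → S) (ac : ℕ → A) (n : ℕ) (i : S) (a : A) (j : S) : ℝ :=
  (transitions st ac n i a j : ℝ) / (visits st ac n i a : ℝ)

/-- The adaptive relaxation parameters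
`w_{n+1} = w_n + α(n) (1 / (1 - γ min_{i,a} P̃_n(i | i, a)) - w_n)`. -/
noncomputable def relaxSeq [Fintype S] [Fintype A] [Nonempty S] [Nonempty A]
    (γ w₀ : ℝ) (α : ℕ → ℝ) (st : ℕ → S) (ac : ℕ → A) : ℕ → ℝ
  | 0 => w₀
  | n + 1 =>
    relaxSeq γ w₀ α st ac n +
      α n * (1 / (1 - γ * Finset.univ.inf' Finset.univ_nonempty
        (fun x : S × A => empProb st ac n x.1 x.2 x.1)) - relaxSeq γ w₀ α st ac n)

/-- Which table selects the maximizing actions `d*`, `e*` in an update of `Q^B`: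
`tableA` means `d* = argmax Q^A(i', ·)`, `e* = argmax Q^A(i, ·)`; `tableB` means
`d* = argmax Q^B(i', ·)`, `e* = argmax Q^B(i, ·)`, the mirror image of an update of `Q^A`. -/
inductive Selector
  | tableA
  | tableB

/-- The row-selecting table of an update of `Q^B`. -/
def Selector.pick {T : Type*} : Selector → T → T → T
  | .tableA, QA, _ => QA
  | .tableB, _, QB => QB

/-- The target `w (r + γ Qev(i', b*)) + (1 - w) Qev(i, c*)` with
`b* = argmax Qsel(i', ·)` and `c* = argmax Qsel(i, ·)`. -/
def sorTarget (am : (A → ℝ) → A) (γ w rew : ℝ) (Qsel Qev : S → A → ℝ) (i i' : S) : ℝ :=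
  w * (rew + γ * Qev i' (am (Qsel i'))) + (1 - w) * Qev i (am (Qsel i))

/-- Replace the entry of `Q` at `(i, a)` by `(1 - β) Q(i, a) + β · target`. -/
def relaxEntry (Q : S → A → ℝ) (i : S) (a : A) (β target : ℝ) : S → A → ℝ := fun i' a' =>
  if i' = i ∧ a' = a then (1 - β) * Q i a + β * target else Q i' a'

/-- Model-free double SOR Q-learning along one sample path: the pair `(Q^A_n, Q^B_n)`.
`coin n = true` means that `Q^A` is updated at iteration `n`, otherwise `Q^B` is. -/
noncomputable def mfDSORQL [Fintype S] (M : MDP S A) (am : (A → ℝ) → A) (sel : Selector)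
    (QA₀ QB₀ : S → A → ℝ) (β : ℕ → S → A → ℝ) (w : ℕ → ℝ)
    (st : ℕ → S) (ac : ℕ → A) (coin : ℕ → Bool) : ℕ → (S → A → ℝ) × (S → A → ℝ)
  | 0 => (QA₀, QB₀)
  | n + 1 =>
    let Q := mfDSORQL M am sel QA₀ QB₀ β w st ac coin n
    let i := st n
    let a := ac n
    let i' := st (n + 1)
    if coin n then
      (relaxEntry Q.1 i a (β n i a)
        (sorTarget am M.γ (w n) (M.r i a i') Q.1 Q.2 i i'), Q.2)
    else
      (Q.1, relaxEntry Q.2 i a (β n i a)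
        (sorTarget am M.γ (w n) (M.r i a i') (sel.pick Q.1 Q.2) Q.1 i i'))

/-- The step size at `(i, a)` in iteration `n` if this pair is sampled then, and `0` otherwise. -/
def activeStep (st : ℕ → S) (ac : ℕ → A) (β : ℕ → S → A → ℝ) (i : S) (a : A) (n : ℕ) : ℝ :=
  if st n = i ∧ ac n = a then β n i a else 0

end Paths

/-- `am` is a rule that picks a maximizing action of every row (with a fixed, measurable way of
breaking ties). -/
structure IsArgmaxRule {A : Type*} (am : (A → ℝ) → A) : Prop where
  le_apply : ∀ (q : A → ℝ) (b : A), q b ≤ q (am q)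
  measurable : ∀ a, MeasurableSet {q : A → ℝ | am q = a}

/-- The random inputs of the algorithm, with the information `𝒢 n` available when iteration `n`
has chosen its action. The action may depend in any way on the past and on extra randomness;
given `𝒢 n`, the next state has law `p(· | i_n, a_n)` and, independently of it, a fair coin
decides which table is updated. The initial tables and the step sizes may be random. -/
structure IsSampling {S A Ω : Type*} [Fintype S] {mΩ : MeasurableSpace Ω} (M : MDP S A)
    (μ : Measure Ω) (𝒢 : Filtration ℕ mΩ) (QA₀ QB₀ : Ω → S → A → ℝ)
    (β : ℕ → Ω → S → A → ℝ) (st : ℕ → Ω → S) (ac : ℕ → Ω → A) (coin : ℕ → Ω → Bool) : Prop where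
  initA_meas : ∀ i a, Measurable[𝒢 0] (fun ω => QA₀ ω i a)
  initB_meas : ∀ i a, Measurable[𝒢 0] (fun ω => QB₀ ω i a)
  step_meas : ∀ n i a, Measurable[𝒢 n] (fun ω => β n ω i a)
  state_meas : ∀ n i, MeasurableSet[𝒢 n] {ω | st n ω = i}
  action_meas : ∀ n a, MeasurableSet[𝒢 n] {ω | ac n ω = a}
  coin_meas : ∀ n c, MeasurableSet[𝒢 (n + 1)] {ω | coin n ω = c}
  law : ∀ n j c,
    μ[Set.indicator {ω | st (n + 1) ω = j ∧ coin n ω = c} (fun _ => (1 : ℝ)) | 𝒢 n]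
      =ᵐ[μ] fun ω => M.p (st n ω) (ac n ω) j * (1 / 2)

/-! ### Deterministic stochastic-approximation recursions -/

/-! Since the coin is fair and independent of the next state, each table moves, in conditional mean,
with step `activeStep / 2` towards `sorMean w_n v`, where `v` collects the values that one table
assigns to the actions selected by a table. The rest is a martingale difference
(`update_eq_mean_add_noise`). Its coefficients are square summable along almost every path, so the
noise series converges almost surely (`ae_tendsto_sum_of_summable_sq`), and a convergent series can
be absorbed into the unknown.

The choice of `w*` makes `v ↦ sorMean w* v` a sup-norm contraction with factor `1 - w* (1 - γ) < 1`.
Empirical self-loop frequencies are consistent, so `w_n → w*`, and replacing `w_n` by `w*` costs a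
null error because the tables are bounded.

`tendsto_zero_of_contraction_of_noise` is then used twice. Both tables have the same mean step size,
and their selected values differ by at most the distance of the tables (`abs_cross_eval_sub_le`);
hence `Q^A - Q^B → 0`. After that, the values used to update `Q^A` agree with `max Q^A` up to a null
error, so `Q^A` is averaged towards a contraction with fixed point `Q*`, and `Q^B` follows. -/

lemma eventually_le_of_averaging {y b : ℕ → ℝ} {c : ℝ} (hb : ∀ n, b n ∈ Set.Icc (0 : ℝ) 1)
    (hb_sum : ¬ Summable b) (h : ∀ᶠ n in atTop, y (n + 1) ≤ (1 - b n) * y n + b n * c)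
    {δ : ℝ} (hδ : 0 < δ) : ∀ᶠ n in atTop, y n ≤ c + δ := by
  obtain ⟨N, hN⟩ := eventually_atTop.1 h
  -- The excess over `c` is multiplied by at most `1 - b ≤ exp (-b)` at each step, and the exponents
  -- sum to infinity. The absolute value keeps the bound nonnegative when `y N < c`.
  have key : ∀ m, y (m + N) - c ≤
      Real.exp (-∑ k ∈ Finset.range m, b (k + N)) * |y N - c| := by
    intro m
    induction m with
    | zero => simpa using le_abs_self (y N - c)
    | succ m ih =>
      have h1 := hN (m + N) (by omega)
      have h2 := hb (m + N)
      have h3 : 1 - b (m + N) ≤ Real.exp (-b (m + N)) := by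
        have := Real.add_one_le_exp (-b (m + N)); linarith
      rw [Finset.sum_range_succ, neg_add, Real.exp_add, show m + 1 + N = m + N + 1 by omega]
      calc y (m + N + 1) - c ≤ (1 - b (m + N)) * (y (m + N) - c) := by linarith
        _ ≤ (1 - b (m + N)) *
            (Real.exp (-∑ k ∈ Finset.range m, b (k + N)) * |y N - c|) :=
          mul_le_mul_of_nonneg_left ih (by linarith [h2.2])
        _ ≤ Real.exp (-b (m + N)) *
            (Real.exp (-∑ k ∈ Finset.range m, b (k + N)) * |y N - c|) :=
          mul_le_mul_of_nonneg_right h3 (by positivity)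
        _ = _ := by ring
  have hs : ¬ Summable fun k => b (k + N) := fun hs => hb_sum ((summable_nat_add_iff N).1 hs)
  have ht : Tendsto (fun m => Real.exp (-∑ k ∈ Finset.range m, b (k + N)) * |y N - c|)
      atTop (𝓝 0) := by
    have := (not_summable_iff_tendsto_nat_atTop_of_nonneg (fun k => (hb (k + N)).1)).1 hs
    simpa using (Real.tendsto_exp_neg_atTop_nhds_zero.comp this).mul_const |y N - c|
  obtain ⟨K, hK⟩ := eventually_atTop.1 (ht.eventually_lt_const hδ)
  refine eventually_atTop.2 ⟨K + N, fun n hn => ?_⟩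
  have h1 := key (n - N)
  have h2 := hK (n - N) (by omega)
  rw [show n - N + N = n by omega] at h1
  linarith

lemma eventually_abs_le_of_averaging {y b G : ℕ → ℝ} {c : ℝ}
    (hb : ∀ n, b n ∈ Set.Icc (0 : ℝ) 1) (hb_sum : ¬ Summable b)
    (hy : ∀ n, y (n + 1) = (1 - b n) * y n + b n * G n)
    (hG : ∀ᶠ n in atTop, |G n| ≤ c) {δ : ℝ} (hδ : 0 < δ) :
    ∀ᶠ n in atTop, |y n| ≤ c + δ := by
  refine eventually_le_of_averaging (y := fun n => |y n|) hb hb_sum ?_ hδ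
  filter_upwards [hG] with n hn
  have h := hb n
  rw [hy]
  calc _ ≤ |(1 - b n) * y n| + |b n * G n| := abs_add_le _ _
    _ = (1 - b n) * |y n| + b n * |G n| := by
      rw [abs_mul, abs_mul, abs_of_nonneg h.1, abs_of_nonneg (by linarith [h.2] : 0 ≤ 1 - b n)]
    _ ≤ _ := by gcongr; exact h.1

/-- A Robbins–Monro average of a null sequence, perturbed by a convergent noise series,
tends to zero. -/
lemma tendsto_zero_of_averaging {x b G ν : ℕ → ℝ} {c : ℝ}
    (hb : ∀ n, b n ∈ Set.Icc (0 : ℝ) 1) (hb_sum : ¬ Summable b)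
    (hν : Tendsto (fun n => ∑ k ∈ Finset.range n, ν k) atTop (𝓝 c))
    (hx : ∀ n, x (n + 1) = (1 - b n) * x n + b n * G n + ν n)
    (hG : Tendsto G atTop (𝓝 0)) : Tendsto x atTop (𝓝 0) := by
  -- Adding the tail `c - ∑ ν` of the noise series to `x` cancels `ν n` exactly: the sum obeys a
  -- noiseless averaging recursion with target `G` plus the same tail.
  have hR : Tendsto (fun n => c - ∑ k ∈ Finset.range n, ν k) atTop (𝓝 0) := by
    simpa using hν.const_sub c
  have hy : Tendsto (fun n => x n + (c - ∑ k ∈ Finset.range n, ν k)) atTop (𝓝 0) := by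
    have hGR : Tendsto (fun n => G n + (c - ∑ k ∈ Finset.range n, ν k)) atTop (𝓝 0) := by
      simpa using hG.add hR
    rw [Metric.tendsto_nhds]
    intro ε hε
    have h1 := eventually_abs_le_of_averaging (c := ε / 4)
      (y := fun n => x n + (c - ∑ k ∈ Finset.range n, ν k))
      (G := fun n => G n + (c - ∑ k ∈ Finset.range n, ν k)) (δ := ε / 4) hb hb_sum
      (fun n => by rw [hx, Finset.sum_range_succ]; ring)
      (((Metric.tendsto_nhds.1 hGR) (ε / 4) (by positivity)).mono fun n hn => by
        rw [Real.dist_0_eq_abs] at hn; exact hn.le) (by positivity)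
    filter_upwards [h1] with n hn
    rw [Real.dist_0_eq_abs]
    linarith
  simpa using hy.sub hR

/-- Asynchronous contraction: if every coordinate is averaged towards a target that is a
`ρ`-contraction of the current vector up to a null sequence, the vector tends to zero. -/
lemma tendsto_zero_of_contraction {κ : Type*} [Finite κ] {y b G : ℕ → κ → ℝ} {ε : ℕ → ℝ}
    {ρ B : ℝ} (hρ : 0 ≤ ρ) (hρ1 : ρ < 1)
    (hb : ∀ n k, b n k ∈ Set.Icc (0 : ℝ) 1) (hb_sum : ∀ k, ¬ Summable fun n => b n k)
    (hB : ∀ n k, |y n k| ≤ B)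
    (hy : ∀ n k, y (n + 1) k = (1 - b n k) * y n k + b n k * G n k)
    (hG : ∀ n C, (∀ k, |y n k| ≤ C) → ∀ k, |G n k| ≤ ρ * C + ε n)
    (hε : Tendsto ε atTop (𝓝 0)) (k : κ) : Tendsto (fun n => y n k) atTop (𝓝 0) := by
  -- `T` is the set of eventual bounds of the sup norm, so `sInf T` is its limsup; the contraction
  -- maps `T` into itself up to an arbitrary `δ`.
  set T : Set ℝ := {C | ∀ᶠ n in atTop, ∀ k, |y n k| ≤ C} with hT
  have hne : T.Nonempty := ⟨B, Eventually.of_forall hB⟩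
  have hnn : ∀ C ∈ T, 0 ≤ C := fun C hC => by
    obtain ⟨n, hn⟩ := hC.exists
    exact (abs_nonneg _).trans (hn k)
  have hbdd : BddBelow T := ⟨0, hnn⟩
  have hstep : ∀ C ∈ T, ∀ δ > 0, ρ * C + δ ∈ T := by
    intro C hC δ hδ
    refine eventually_all.2 fun k => ?_
    have h1 : ∀ᶠ n in atTop, |G n k| ≤ ρ * C + δ / 2 := by
      filter_upwards [hC, hε.eventually_lt_const (half_pos hδ)] with n hn hn'
      linarith [hG n C hn k]
    have := eventually_abs_le_of_averaging (y := fun n => y n k) (fun n => hb n k) (hb_sum k)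
      (fun n => hy n k) h1
      (half_pos hδ)
    filter_upwards [this] with n hn
    linarith
  have hL0 : 0 ≤ sInf T := le_csInf hne hnn
  have hL : sInf T = 0 := by
    by_contra hcon
    have hpos : 0 < sInf T := lt_of_le_of_ne hL0 (Ne.symm hcon)
    -- For `C < L + δ` with `L = sInf T`, one gets `ρ C + δ < ρ L + 2 δ = ρ L + (1 - ρ) L / 2 < L`,
    -- contradicting minimality.
    set δ := (1 - ρ) * sInf T / 4 with hδ
    have hδpos : 0 < δ := by have := sub_pos.2 hρ1; positivity
    obtain ⟨C, hC, hCL⟩ := exists_lt_of_csInf_lt hne (lt_add_of_pos_right (sInf T) hδpos)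
    have h1 := csInf_le hbdd (hstep C hC δ hδpos)
    nlinarith
  rw [Metric.tendsto_nhds]
  intro η hη
  obtain ⟨C, hC, hCη⟩ := exists_lt_of_csInf_lt hne (hL ▸ hη : sInf T < η)
  filter_upwards [hC] with n hn
  rw [Real.dist_0_eq_abs]
  exact (hn k).trans_lt hCη

/-- The contraction principle in the presence of a convergent noise series. -/
lemma tendsto_zero_of_contraction_of_noise {κ : Type*} [Finite κ] {x b G ν : ℕ → κ → ℝ}
    {ε : ℕ → ℝ} {ρ B : ℝ} (hρ : 0 ≤ ρ) (hρ1 : ρ < 1)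
    (hb : ∀ n k, b n k ∈ Set.Icc (0 : ℝ) 1) (hb_sum : ∀ k, ¬ Summable fun n => b n k)
    (hB : ∀ n k, |x n k| ≤ B)
    (hν : ∀ k, ∃ c, Tendsto (fun n => ∑ m ∈ Finset.range n, ν m k) atTop (𝓝 c))
    (hx : ∀ n k, x (n + 1) k = (1 - b n k) * x n k + b n k * G n k + ν n k)
    (hG : ∀ n C, (∀ k, |x n k| ≤ C) → ∀ k, |G n k| ≤ ρ * C + ε n)
    (hε : Tendsto ε atTop (𝓝 0)) (k : κ) : Tendsto (fun n => x n k) atTop (𝓝 0) := by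
  have := Fintype.ofFinite κ
  choose c hc using hν
  -- The tail of the noise series again serves as a correction. It shifts the vector by at most `r
  -- n`, which changes the contraction bound only by the null terms `ρ * r n + r n`.
  set R : ℕ → κ → ℝ := fun n k => c k - ∑ m ∈ Finset.range n, ν m k with hRdef
  have hR : ∀ k, Tendsto (fun n => R n k) atTop (𝓝 0) := fun k => by
    simpa using (hc k).const_sub (c k)
  set r : ℕ → ℝ := fun n => ∑ k, |R n k| with hrdef
  have hr : Tendsto r atTop (𝓝 0) := by
    simpa using tendsto_finsetSum Finset.univ fun k _ => (hR k).abs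
  have hRr : ∀ n k, |R n k| ≤ r n := fun n k =>
    Finset.single_le_sum (f := fun k => |R n k|) (fun _ _ => abs_nonneg _) (Finset.mem_univ k)
  obtain ⟨K, hK⟩ := hr.bddAbove_range
  have hy := tendsto_zero_of_contraction (y := fun n k => x n k + R n k)
    (G := fun n k => G n k + R n k) (ε := fun n => ρ * r n + ε n + r n) (B := B + K)
    hρ hρ1 hb hb_sum
    (fun n k => (abs_add_le _ _).trans
      (add_le_add (hB n k) ((hRr n k).trans (hK ⟨n, rfl⟩))))
    (fun n k => by simp only [hRdef]; rw [hx, Finset.sum_range_succ]; ring)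
    (fun n C hC k => by
      have h1 : ∀ k, |x n k| ≤ C + r n := fun k => by
        have h2 := abs_sub (x n k + R n k) (R n k)
        rw [add_sub_cancel_right] at h2
        linarith [hC k, hRr n k]
      calc _ ≤ |G n k| + |R n k| := abs_add_le _ _
        _ ≤ ρ * (C + r n) + ε n + r n := add_le_add (hG n _ h1 k) (hRr n k)
        _ = _ := by ring)
    (by simpa using ((hr.const_mul ρ).add hε).add hr) k
  simpa using hy.sub (hR k)

/-! ### Almost sure convergence of martingale transforms -/

section MartingaleTransform

variable {Ω : Type*} {mΩ : MeasurableSpace Ω} {μ : Measure Ω} [IsProbabilityMeasure μ]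
  {𝒢 : Filtration ℕ mΩ} {g ξ : ℕ → Ω → ℝ}

lemma integral_mul_eq_zero_of_condExp_eq_zero {m : MeasurableSpace Ω} (hm : m ≤ mΩ)
    {f η : Ω → ℝ} (hf : StronglyMeasurable[m] f) {c : ℝ} (hfc : ∀ ω, |f ω| ≤ c)
    (hη : Integrable η μ) (h0 : μ[η | m] =ᵐ[μ] 0) : ∫ ω, f ω * η ω ∂μ = 0 := by
  have h1 : μ[f * η | m] =ᵐ[μ] 0 := by
    filter_upwards [condExp_stronglyMeasurable_mul_of_bound hm hf hη c
      (ae_of_all _ fun ω => hfc ω), h0] with ω h1 h2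
    rw [h1, Pi.mul_apply, h2]
    simp
  calc ∫ ω, f ω * η ω ∂μ = ∫ ω, (μ[f * η | m]) ω ∂μ := (integral_condExp hm).symm
    _ = 0 := by rw [integral_congr_ae h1]; simp

/-- The partial sums form a martingale. Its increments are orthogonal, so its second moment is at
most `N`, and the martingale convergence theorem applies. -/
lemma ae_tendsto_sum_of_bounded_variation {N : ℝ}
    (hg : ∀ n, StronglyMeasurable[𝒢 n] (g n))
    (hξ : ∀ n, StronglyMeasurable[𝒢 (n + 1)] (ξ n)) (hξ1 : ∀ n ω, |ξ n ω| ≤ 1)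
    (hξ0 : ∀ n, μ[ξ n | 𝒢 n] =ᵐ[μ] 0)
    (hN : ∀ n ω, ∑ k ∈ Finset.range n, g k ω ^ 2 ≤ N) :
    ∀ᵐ ω ∂μ, ∃ c, Tendsto (fun n => ∑ k ∈ Finset.range n, g k ω * ξ k ω) atTop (𝓝 c) := by
  set X : ℕ → Ω → ℝ := fun n ω => ∑ k ∈ Finset.range n, g k ω * ξ k ω with hX
  have hgb : ∀ n ω, |g n ω| ≤ 1 + N := fun n ω => by
    have h1 := hN (n + 1) ω
    have h2 : g n ω ^ 2 ≤ ∑ k ∈ Finset.range (n + 1), g k ω ^ 2 :=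
      Finset.single_le_sum (f := fun k => g k ω ^ 2) (fun _ _ => sq_nonneg _)
        (Finset.self_mem_range_succ n)
    rw [abs_le]
    constructor <;> nlinarith [sq_nonneg (g n ω - 1), sq_nonneg (g n ω + 1)]
  have hgξb : ∀ n ω, |g n ω * ξ n ω| ≤ 1 + N := fun n ω => by
    rw [abs_mul]
    calc _ ≤ |g n ω| * 1 := mul_le_mul_of_nonneg_left (hξ1 n ω) (abs_nonneg _)
      _ ≤ _ := by rw [mul_one]; exact hgb n ω
  have hXb : ∀ n ω, |X n ω| ≤ n * (1 + N) := fun n ω => by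
    calc |X n ω| ≤ ∑ k ∈ Finset.range n, |g k ω * ξ k ω| := Finset.abs_sum_le_sum_abs _ _
      _ ≤ ∑ k ∈ Finset.range n, (1 + N) := Finset.sum_le_sum fun k _ => hgξb k ω
      _ = _ := by rw [Finset.sum_const, Finset.card_range, nsmul_eq_mul]
  have hgm : ∀ n, StronglyMeasurable (g n) := fun n => (hg n).mono (𝒢.le n)
  have hξm : ∀ n, StronglyMeasurable (ξ n) := fun n => (hξ n).mono (𝒢.le _)
  have hXad : ∀ n, StronglyMeasurable[𝒢 n] (X n) := fun n => by
    refine Finset.stronglyMeasurable_fun_sum _ fun k hk => ?_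
    have hk := Finset.mem_range.1 hk
    exact ((hg k).mono (𝒢.mono hk.le)).mul ((hξ k).mono (𝒢.mono hk))
  have hXm : ∀ n, StronglyMeasurable (X n) := fun n => (hXad n).mono (𝒢.le n)
  have hXi : ∀ n, Integrable (X n) μ := fun n =>
    Integrable.of_bound (hXm n).aestronglyMeasurable _ (ae_of_all _ fun ω => hXb n ω)
  have hξi : ∀ n, Integrable (ξ n) μ := fun n =>
    Integrable.of_bound (hξm n).aestronglyMeasurable _ (ae_of_all _ fun ω => hξ1 n ω)
  have hmart : Martingale X 𝒢 μ := by
    refine martingale_of_condExp_sub_eq_zero_nat hXad hXi fun n => ?_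
    have h1 : X (n + 1) - X n = g n * ξ n := by
      ext ω
      simp [hX, Finset.sum_range_succ]
    rw [h1]
    filter_upwards [condExp_stronglyMeasurable_mul_of_bound (𝒢.le n) (hg n) (hξi n) (1 + N)
      (ae_of_all _ fun ω => hgb n ω), hξ0 n] with ω h2 h3
    rw [h2, Pi.mul_apply, h3]
    simp
  have hX2i : ∀ n, Integrable (fun ω => X n ω ^ 2) μ := fun n =>
    Integrable.of_bound ((hXm n).pow 2).aestronglyMeasurable ((n * (1 + N)) ^ 2)
      (ae_of_all _ fun ω => by
        rw [Real.norm_eq_abs, abs_pow]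
        exact pow_le_pow_left₀ (abs_nonneg _) (hXb n ω) 2)
  have hgξ2i : ∀ n, Integrable (fun ω => (g n ω * ξ n ω) ^ 2) μ := fun n =>
    Integrable.of_bound (((hgm n).mul (hξm n)).pow 2).aestronglyMeasurable ((1 + N) ^ 2)
      (ae_of_all _ fun ω => by
        rw [Real.norm_eq_abs, abs_pow]
        exact pow_le_pow_left₀ (abs_nonneg _) (hgξb n ω) 2)
  have hg2i : ∀ n, Integrable (fun ω => g n ω ^ 2) μ := fun n =>
    Integrable.of_bound ((hgm n).pow 2).aestronglyMeasurable ((1 + N) ^ 2)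
      (ae_of_all _ fun ω => by
        rw [Real.norm_eq_abs, abs_pow]
        exact pow_le_pow_left₀ (abs_nonneg _) (hgb n ω) 2)
  have hXgb : ∀ n ω, |X n ω * g n ω| ≤ n * (1 + N) * (1 + N) := fun n ω => by
    rw [abs_mul]
    exact mul_le_mul (hXb n ω) (hgb n ω) (abs_nonneg _) ((abs_nonneg _).trans (hXb n ω))
  have hcross : ∀ n, ∫ ω, X n ω * g n ω * ξ n ω ∂μ = 0 := fun n =>
    integral_mul_eq_zero_of_condExp_eq_zero (𝒢.le n) ((hXad n).mul (hg n)) (hXgb n)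
      (hξi n) (hξ0 n)
  have hcrossi : ∀ n, Integrable (fun ω => X n ω * g n ω * ξ n ω) μ := fun n =>
    (hξi n).bdd_mul (c := n * (1 + N) * (1 + N)) ((hXm n).mul (hgm n)).aestronglyMeasurable
      (ae_of_all _ fun ω => hXgb n ω)
  have hvar : ∀ n, ∫ ω, X n ω ^ 2 ∂μ ≤ ∫ ω, ∑ k ∈ Finset.range n, g k ω ^ 2 ∂μ := by
    intro n
    induction n with
    | zero => simp [hX]
    | succ n ih =>
      have h1 : ∀ ω, X (n + 1) ω ^ 2 =
          X n ω ^ 2 + 2 * (X n ω * g n ω * ξ n ω) + (g n ω * ξ n ω) ^ 2 := fun ω => by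
        simp only [hX, Finset.sum_range_succ]; ring
      simp_rw [h1, Finset.sum_range_succ]
      rw [integral_add (f := fun ω => X n ω ^ 2 + 2 * (X n ω * g n ω * ξ n ω))
          ((hX2i n).add ((hcrossi n).const_mul 2)) (hgξ2i n),
        integral_add (hX2i n) ((hcrossi n).const_mul 2), integral_const_mul, hcross,
        integral_add (integrable_finsetSum _ fun k _ => hg2i k) (hg2i n)]
      have h2 : ∫ ω, (g n ω * ξ n ω) ^ 2 ∂μ ≤ ∫ ω, g n ω ^ 2 ∂μ :=
        integral_mono (hgξ2i n) (hg2i n) fun ω => by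
          have h3 : ξ n ω ^ 2 ≤ 1 := (sq_le_one_iff_abs_le_one _).2 (hξ1 n ω)
          simp only [mul_pow]
          nlinarith [sq_nonneg (g n ω)]
      linarith
  -- The required `L¹` bound comes from `|x| ≤ 1 + x²` and the variance estimate.
  refine hmart.submartingale.exists_ae_tendsto_of_bdd (R := (1 + N).toNNReal) fun n => ?_
  rw [eLpNorm_one_eq_lintegral_enorm, ← ofReal_integral_norm_eq_lintegral_enorm (hXi n)]
  refine ENNReal.ofReal_le_ofReal ?_
  calc ∫ ω, ‖X n ω‖ ∂μ ≤ ∫ ω, (1 + X n ω ^ 2) ∂μ :=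
        integral_mono (hXi n).norm ((integrable_const 1).add (hX2i n)) fun ω => by
          simp only [Real.norm_eq_abs]
          nlinarith [sq_abs (X n ω), sq_nonneg (|X n ω| - 1)]
    _ = 1 + ∫ ω, X n ω ^ 2 ∂μ := by
      rw [integral_add (integrable_const 1) (hX2i n)]; simp
    _ ≤ 1 + ∫ ω, ∑ k ∈ Finset.range n, g k ω ^ 2 ∂μ := by linarith [hvar n]
    _ ≤ 1 + ∫ _, N ∂μ := by
      gcongr
      · exact integrable_finsetSum _ fun k _ => hg2i k
      · exact integrable_const N
      · exact fun ω => hN n ω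
    _ = 1 + N := by simp

/-- If `g` is adapted with `∑ g² < ∞` almost surely and `ξ` is a bounded martingale difference
sequence, then `∑ g ξ` converges almost surely. -/
lemma ae_tendsto_sum_of_summable_sq
    (hg : ∀ n, StronglyMeasurable[𝒢 n] (g n))
    (hξ : ∀ n, StronglyMeasurable[𝒢 (n + 1)] (ξ n)) (hξ1 : ∀ n ω, |ξ n ω| ≤ 1)
    (hξ0 : ∀ n, μ[ξ n | 𝒢 n] =ᵐ[μ] 0)
    (hsq : ∀ᵐ ω ∂μ, Summable fun n => g n ω ^ 2) :
    ∀ᵐ ω ∂μ, ∃ c, Tendsto (fun n => ∑ k ∈ Finset.range n, g k ω * ξ k ω) atTop (𝓝 c) := by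
  classical
  -- Truncation at level `N`. The `n`-th square is included in the test, which is allowed because `g
  -- n` is known at time `n`, and it keeps the truncated sum of squares below `N`. A path with `∑ g²
  -- ≤ N` is not truncated at all.
  set h : ℕ → ℕ → Ω → ℝ := fun N n ω =>
    if ∑ k ∈ Finset.range (n + 1), g k ω ^ 2 ≤ N then g n ω else 0 with hh
  have hmeas : ∀ N n, StronglyMeasurable[𝒢 n] (h N n) := fun N n => by
    refine StronglyMeasurable.ite (measurableSet_le ?_ measurable_const) (hg n)
      stronglyMeasurable_const
    refine Finset.measurable_fun_sum _ fun k hk => ?_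
    have hk := Nat.lt_succ_iff.1 (Finset.mem_range.1 hk)
    exact ((hg k).mono (𝒢.mono hk)).measurable.pow_const 2
  have hbound : ∀ (N n : ℕ) ω, ∑ k ∈ Finset.range n, h N k ω ^ 2 ≤ N := by
    intro N n ω
    induction n with
    | zero => simp
    | succ n ih =>
      by_cases hc : ∑ k ∈ Finset.range (n + 1), g k ω ^ 2 ≤ N
      · refine (Finset.sum_le_sum fun k _ => ?_).trans hc
        simp only [hh]
        split_ifs
        · exact le_rfl
        · simpa using sq_nonneg (g k ω)
      · rw [Finset.sum_range_succ]
        simpa [hh, hc] using ih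
  have hall := ae_all_iff.2 fun N => ae_tendsto_sum_of_bounded_variation (hmeas N) hξ hξ1 hξ0
    (hbound N)
  filter_upwards [hall, hsq] with ω hω hs
  obtain ⟨N, hN⟩ := exists_nat_ge (∑' n, g n ω ^ 2)
  obtain ⟨c, hc⟩ := hω N
  refine ⟨c, hc.congr fun n => Finset.sum_congr rfl fun k _ => ?_⟩
  have : ∑ k ∈ Finset.range (k + 1), g k ω ^ 2 ≤ N :=
    (hs.sum_le_tsum _ fun _ _ => sq_nonneg _).trans hN
  simp [hh, this]

end MartingaleTransform

/-! ### The relaxed Bellman operator -/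

lemma maxOp_eq_apply_argmax {S A : Type*} [Fintype A] [Nonempty A] {am : (A → ℝ) → A}
    (ham : IsArgmaxRule am) (Q : S → A → ℝ) (i : S) : maxOp Q i = Q i (am (Q i)) :=
  le_antisymm (Finset.sup'_le _ _ fun b _ => ham.le_apply (Q i) b)
    (Finset.le_sup' (fun b => Q i b) (Finset.mem_univ _))

lemma abs_maxOp_sub_maxOp_le {S A : Type*} [Fintype A] [Nonempty A] {Q Q' : S → A → ℝ} {C : ℝ}
    (h : ∀ i a, |Q i a - Q' i a| ≤ C) (i : S) : |maxOp Q i - maxOp Q' i| ≤ C := by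
  have aux : ∀ {Q Q' : S → A → ℝ}, (∀ i a, |Q i a - Q' i a| ≤ C) →
      maxOp Q i ≤ maxOp Q' i + C := fun {Q Q'} h => by
    refine Finset.sup'_le _ _ fun b _ => ?_
    have h1 : Q' i b ≤ maxOp Q' i := Finset.le_sup' (fun b => Q' i b) (Finset.mem_univ b)
    linarith [(abs_le.1 (h i b)).2]
  have h1 := aux h
  have h2 := aux fun i a => (abs_sub_comm (Q' i a) (Q i a)).trans_le (h i a)
  rw [abs_le]
  constructor <;> linarith

namespace MDP

variable {S A : Type*} [Fintype S]

lemma p_le_one (M : MDP S A) (i : S) (a : A) (j : S) : M.p i a j ≤ 1 := by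
  rw [← M.p_sum i a]
  exact Finset.single_le_sum (fun j _ => M.p_nonneg i a j) (Finset.mem_univ j)

lemma one_sub_mul_pos (M : MDP S A) {x : ℝ} (hx1 : x ≤ 1) :
    0 < 1 - M.γ * x := by
  nlinarith [M.γ_nonneg, M.γ_lt_one]

/-- The expected target of an update at `(i, a)` with relaxation parameter `w` and state
values `v`. -/
noncomputable def sorMean (M : MDP S A) (w : ℝ) (v : S → ℝ) (i : S) (a : A) : ℝ :=
  w * (M.meanReward i a + M.γ * ∑ j, M.p i a j * v j) + (1 - w) * v i

lemma sorMean_eq_sum (M : MDP S A) (w : ℝ) (v : S → ℝ) (i : S) (a : A) :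
    M.sorMean w v i a =
      ∑ j, M.p i a j * (w * (M.r i a j + M.γ * v j) + (1 - w) * v i) := by
  have h : ∀ j, M.p i a j * (w * (M.r i a j + M.γ * v j) + (1 - w) * v i) =
      w * (M.p i a j * M.r i a j) + w * M.γ * (M.p i a j * v j) +
        (1 - w) * v i * M.p i a j := fun j => by ring
  simp_rw [h, Finset.sum_add_distrib, ← Finset.mul_sum, M.p_sum, sorMean, meanReward]
  ring

/-- The mean target is affine in `w`, with slope bounded in terms of rewards and values; this
controls the cost of using `w_n` in place of `w*`. -/
lemma abs_sorMean_sub_sorMean_relax_le (M : MDP S A) {w w' : ℝ} {v : S → ℝ} {B R : ℝ}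
    (hv : ∀ j, |v j| ≤ B) (i : S) (a : A) (hR : |M.meanReward i a| ≤ R) :
    |M.sorMean w v i a - M.sorMean w' v i a| ≤ |w - w'| * (R + 2 * B) := by
  have h1 : M.sorMean w v i a - M.sorMean w' v i a =
      (w - w') * (M.meanReward i a + M.γ * ∑ j, M.p i a j * v j - v i) := by
    simp only [sorMean]; ring
  have hB : 0 ≤ B := (abs_nonneg _).trans (hv i)
  have h2 : |∑ j, M.p i a j * v j| ≤ B := by
    calc _ ≤ ∑ j, |M.p i a j * v j| := Finset.abs_sum_le_sum_abs _ _
      _ ≤ ∑ j, M.p i a j * B := Finset.sum_le_sum fun j _ => by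
        rw [abs_mul, abs_of_nonneg (M.p_nonneg i a j)]
        exact mul_le_mul_of_nonneg_left (hv j) (M.p_nonneg i a j)
      _ = B := by rw [← Finset.sum_mul, M.p_sum, one_mul]
  have h3 : |M.γ * ∑ j, M.p i a j * v j| ≤ B := by
    rw [abs_mul, abs_of_nonneg M.γ_nonneg]
    nlinarith [M.γ_nonneg, M.γ_lt_one, abs_nonneg (∑ j, M.p i a j * v j)]
  rw [h1, abs_mul]
  refine mul_le_mul_of_nonneg_left ?_ (abs_nonneg _)
  calc _ ≤ |M.meanReward i a + M.γ * ∑ j, M.p i a j * v j| + |v i| := abs_sub _ _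
    _ ≤ |M.meanReward i a| + |M.γ * ∑ j, M.p i a j * v j| + |v i| := by
      gcongr; exact abs_add_le _ _
    _ ≤ R + 2 * B := by linarith [hv i]

variable [Fintype A] [Nonempty S] [Nonempty A]

lemma one_le_wStar (M : MDP S A) : 1 ≤ M.wStar := by
  refine Finset.le_inf' _ _ fun x _ => ?_
  rw [one_le_div (M.one_sub_mul_pos (M.p_le_one _ _ _))]
  nlinarith [mul_nonneg M.γ_nonneg (M.p_nonneg x.1 x.2 x.1)]

lemma wStar_mul_le_one (M : MDP S A) (i : S) (a : A) :
    M.wStar * (1 - M.γ * M.p i a i) ≤ 1 := by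
  have h : M.wStar ≤ 1 / (1 - M.γ * M.p i a i) :=
    Finset.inf'_le (fun x : S × A => 1 / (1 - M.γ * M.p x.1 x.2 x.1)) (Finset.mem_univ (i, a))
  exact (le_div_iff₀ (M.one_sub_mul_pos (M.p_le_one _ _ _))).1 h

/-- The contraction factor `1 - w* (1 - γ)` of the optimally relaxed Bellman operator. -/
noncomputable def sorFactor (M : MDP S A) : ℝ := 1 - M.wStar * (1 - M.γ)

lemma sorFactor_nonneg (M : MDP S A) : 0 ≤ M.sorFactor := by
  obtain ⟨i⟩ := ‹Nonempty S›
  obtain ⟨a⟩ := ‹Nonempty A›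
  have h1 := M.wStar_mul_le_one i a
  have h2 := M.one_le_wStar
  have h3 : M.γ * M.p i a i ≤ M.γ := mul_le_of_le_one_right M.γ_nonneg (M.p_le_one i a i)
  rw [sorFactor]
  nlinarith

lemma sorFactor_lt_one (M : MDP S A) : M.sorFactor < 1 := by
  have h1 := M.one_le_wStar
  have h2 := M.γ_lt_one
  rw [sorFactor]
  nlinarith

/-- As a function of `v`, the target is affine with coefficients `c j`. The only one that might be
negative is `c i = 1 - w* (1 - γ p(i | i, a))`, and the definition of `w*` excludes this. The
Lipschitz constant is therefore the sum of the coefficients, `1 - w* (1 - γ)`. -/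
lemma abs_sorMean_sub_sorMean_le (M : MDP S A) {v v' : S → ℝ} {C : ℝ}
    (h : ∀ j, |v j - v' j| ≤ C) (i : S) (a : A) :
    |M.sorMean M.wStar v i a - M.sorMean M.wStar v' i a| ≤ M.sorFactor * C := by
  classical
  set c : S → ℝ := fun j => M.wStar * M.γ * M.p i a j + if j = i then 1 - M.wStar else 0 with hc
  have hw := M.one_le_wStar
  have hc0 : ∀ j, 0 ≤ c j := fun j => by
    by_cases hj : j = i
    · subst hj
      have := M.wStar_mul_le_one j a
      simp only [hc, if_true]
      linarith
    · simp only [hc, hj, if_false, add_zero]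
      exact mul_nonneg (mul_nonneg (by linarith) M.γ_nonneg) (M.p_nonneg _ _ _)
  have hcs : ∑ j, c j = M.sorFactor := by
    simp only [hc, Finset.sum_add_distrib, ← Finset.mul_sum, M.p_sum, sorFactor,
      Finset.sum_ite_eq', Finset.mem_univ, if_true]
    ring
  have hm : ∀ v : S → ℝ, M.sorMean M.wStar v i a =
      M.wStar * M.meanReward i a + ∑ j, c j * v j := fun v => by
    simp only [hc, sorMean, add_mul, Finset.sum_add_distrib, ite_mul, zero_mul,
      Finset.sum_ite_eq', Finset.mem_univ, if_true, mul_assoc, ← Finset.mul_sum]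
    ring
  rw [hm, hm, add_sub_add_left_eq_sub, ← Finset.sum_sub_distrib, ← hcs, Finset.sum_mul]
  refine (Finset.abs_sum_le_sum_abs _ _).trans (Finset.sum_le_sum fun j _ => ?_)
  rw [← mul_sub, abs_mul, abs_of_nonneg (hc0 j)]
  exact mul_le_mul_of_nonneg_left (h j) (hc0 j)

lemma contractingWith_sorOp (M : MDP S A) :
    ContractingWith ⟨M.sorFactor, M.sorFactor_nonneg⟩ (M.sorOp M.wStar) := by
  refine ⟨M.sorFactor_lt_one, LipschitzWith.of_dist_le_mul fun Q Q' => ?_⟩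
  have hd : ∀ i a, |Q i a - Q' i a| ≤ dist Q Q' := fun i a => by
    rw [← Real.dist_eq]
    exact (dist_le_pi_dist (Q i) (Q' i) a).trans (dist_le_pi_dist Q Q' i)
  have h0 : 0 ≤ M.sorFactor * dist Q Q' := mul_nonneg M.sorFactor_nonneg dist_nonneg
  refine (dist_pi_le_iff h0).2 fun i => (dist_pi_le_iff h0).2 fun a => ?_
  rw [Real.dist_eq]
  exact M.abs_sorMean_sub_sorMean_le (abs_maxOp_sub_maxOp_le hd) i a

lemma exists_unique_fixedPt_sorOp (M : MDP S A) :
    ∃ Q : S → A → ℝ, Function.IsFixedPt (M.sorOp M.wStar) Q ∧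
      ∀ Q', Function.IsFixedPt (M.sorOp M.wStar) Q' → Q' = Q :=
  ⟨_, M.contractingWith_sorOp.fixedPoint_isFixedPt,
    fun _ h => M.contractingWith_sorOp.fixedPoint_unique h⟩

/-- The map `x ↦ 1 / (1 - γ x)` is increasing on `x ≤ 1`, so it commutes with the minimum. This
identifies the limit of the targets in the relaxation recursion. -/
lemma one_div_one_sub_inf'_eq_wStar (M : MDP S A) :
    1 / (1 - M.γ * Finset.univ.inf' Finset.univ_nonempty
      (fun x : S × A => M.p x.1 x.2 x.1)) = M.wStar := by
  set f : S × A → ℝ := fun x => M.p x.1 x.2 x.1 with hf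
  obtain ⟨y, -, hy⟩ := Finset.exists_mem_eq_inf' (Finset.univ_nonempty (α := S × A)) f
  have hpos : 0 < 1 - M.γ * f y := M.one_sub_mul_pos (M.p_le_one _ _ _)
  refine le_antisymm (Finset.le_inf' _ _ fun x _ => ?_) ?_
  · refine one_div_le_one_div_of_le
      (M.one_sub_mul_pos (M.p_le_one _ _ _)) ?_
    exact sub_le_sub_left (mul_le_mul_of_nonneg_left
      (Finset.inf'_le f (Finset.mem_univ x)) M.γ_nonneg) 1
  · rw [hy]
    exact Finset.inf'_le (fun x : S × A => 1 / (1 - M.γ * M.p x.1 x.2 x.1)) (Finset.mem_univ y)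

end MDP

/-- The rows of the two tables picked by a double update differ, entry by entry, by at most the
distance of the tables. -/
lemma abs_cross_eval_sub_le {S A : Type*} {am : (A → ℝ) → A} (ham : IsArgmaxRule am)
    (sel : Selector) {Q Q' : S → A → ℝ} {C : ℝ} (h : ∀ i a, |Q i a - Q' i a| ≤ C) (j : S) :
    |Q' j (am (Q j)) - Q j (am (sel.pick Q Q' j))| ≤ C := by
  cases sel with
  | tableA =>
    rw [abs_sub_comm]
    exact h j _
  | tableB =>
    -- With `a`, `a'` maximizing `Q`, `Q'`: `Q' a ≤ Q' a' ≤ Q a' + C` and `Q a' ≤ Q a ≤ Q' a + C`.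
    have h1 := (abs_le.1 (h j (am (Q j)))).2
    have h2 := (abs_le.1 (h j (am (Q' j)))).1
    have h3 := ham.le_apply (Q j) (am (Q' j))
    have h4 := ham.le_apply (Q' j) (am (Q j))
    simp only [Selector.pick]
    rw [abs_le]
    constructor <;> linarith

/-! ### Empirical frequencies and relaxation parameters along a path -/

section Paths

variable {S A : Type*} [DecidableEq S] [DecidableEq A] {st : ℕ → S} {ac : ℕ → A}

lemma visits_succ (n : ℕ) (i : S) (a : A) :
    visits st ac (n + 1) i a = visits st ac n i a + if st n = i ∧ ac n = a then 1 else 0 := by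
  simp only [visits, Finset.card_filter, Finset.sum_range_succ]

lemma transitions_succ (n : ℕ) (i : S) (a : A) (j : S) :
    transitions st ac (n + 1) i a j = transitions st ac n i a j +
      if st n = i ∧ ac n = a ∧ st (n + 1) = j then 1 else 0 := by
  simp only [transitions, Finset.card_filter, Finset.sum_range_succ]

lemma transitions_le_visits (n : ℕ) (i : S) (a : A) (j : S) :
    transitions st ac n i a j ≤ visits st ac n i a :=
  Finset.card_le_card (Finset.monotone_filter_right _ fun _ _ h => ⟨h.1, h.2.1⟩)

lemma tendsto_visits {i : S} {a : A} (h : ∃ᶠ n in atTop, st n = i ∧ ac n = a) :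
    Tendsto (fun n => visits st ac n i a) atTop atTop := by
  refine tendsto_atTop_atTop_of_monotone
    (monotone_nat_of_le_succ fun n => by rw [visits_succ]; omega) fun b => ?_
  induction b with
  | zero => exact ⟨0, Nat.zero_le _⟩
  | succ b ih =>
    obtain ⟨n, hn⟩ := ih
    obtain ⟨m, hm, hv⟩ := frequently_atTop.1 h n
    have hmono : Monotone fun n => visits st ac n i a :=
      monotone_nat_of_le_succ fun n => by rw [visits_succ]; omega
    refine ⟨m + 1, ?_⟩
    have := hmono hm
    simp only at this
    rw [visits_succ, if_pos hv]
    omega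

/-- The step size of the empirical average at `(i, a)`: the inverse of the updated number of
visits when `(i, a)` is sampled, and `0` otherwise. -/
noncomputable def empStep (st : ℕ → S) (ac : ℕ → A) (i : S) (a : A) (n : ℕ) : ℝ :=
  if st n = i ∧ ac n = a then 1 / ((visits st ac n i a : ℝ) + 1) else 0

lemma empStep_mem_Icc (i : S) (a : A) (n : ℕ) : empStep st ac i a n ∈ Set.Icc (0 : ℝ) 1 := by
  rw [empStep]
  split_ifs
  · refine ⟨by positivity, ?_⟩
    rw [div_le_one (by positivity)]
    linarith [(Nat.cast_nonneg (visits st ac n i a) : (0 : ℝ) ≤ _)]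
  · simp

/-- A change of clock from iterations to visits: the sums of `empStep` and its square become those
of the harmonic series and of `∑ 1 / m²`. -/
lemma sum_range_visits (φ : ℕ → ℝ) (i : S) (a : A) (n : ℕ) :
    ∑ k ∈ Finset.range n, (if st k = i ∧ ac k = a then φ (visits st ac k i a) else 0) =
      ∑ m ∈ Finset.range (visits st ac n i a), φ m := by
  induction n with
  | zero => simp [visits]
  | succ n ih =>
    rw [Finset.sum_range_succ, ih, visits_succ]
    split_ifs
    · rw [Finset.sum_range_succ]
    · simp

lemma not_summable_empStep {i : S} {a : A} (h : ∃ᶠ n in atTop, st n = i ∧ ac n = a) :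
    ¬ Summable (empStep st ac i a) := by
  rw [not_summable_iff_tendsto_nat_atTop_of_nonneg fun n => (empStep_mem_Icc i a n).1]
  exact (Real.tendsto_sum_range_one_div_nat_succ_atTop.comp (tendsto_visits h)).congr
    fun n => (sum_range_visits (fun m => 1 / ((m : ℝ) + 1)) i a n).symm

lemma summable_empStep_sq (i : S) (a : A) : Summable fun n => empStep st ac i a n ^ 2 := by
  have hs : Summable fun m : ℕ => (1 / ((m : ℝ) + 1)) ^ 2 := by
    have := (summable_nat_add_iff 1).2 (Real.summable_one_div_nat_pow.2 one_lt_two)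
    simpa [div_pow] using this
  refine summable_of_sum_range_le (c := ∑' m : ℕ, (1 / ((m : ℝ) + 1)) ^ 2)
    (fun _ => sq_nonneg _) fun n => ?_
  calc _ = ∑ m ∈ Finset.range (visits st ac n i a), (1 / ((m : ℝ) + 1)) ^ 2 := by
        rw [← sum_range_visits]
        refine Finset.sum_congr rfl fun k _ => ?_
        rw [empStep]
        split_ifs <;> simp
    _ ≤ _ := hs.sum_le_tsum _ fun _ _ => sq_nonneg _

/-- Puts the empirical frequency in Robbins–Monro form. At the first visit the step is `1`, so the
default value `0` is forgotten. -/
lemma empProb_succ (n : ℕ) (i : S) (a : A) (j : S) :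
    empProb st ac (n + 1) i a j = (1 - empStep st ac i a n) * empProb st ac n i a j +
      empStep st ac i a n * if st (n + 1) = j then 1 else 0 := by
  by_cases h : st n = i ∧ ac n = a
  · have ht : transitions st ac (n + 1) i a j =
        transitions st ac n i a j + if st (n + 1) = j then 1 else 0 := by
      rw [transitions_succ]; simp [h]
    rw [empProb, empProb, ht, visits_succ, empStep, if_pos h, if_pos h]
    have hle := transitions_le_visits (st := st) (ac := ac) n i a j
    rcases Nat.eq_zero_or_pos (visits st ac n i a) with hv | hv
    · have : transitions st ac n i a j = 0 := by omega
      rw [hv, this]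
      simp
    · have hv' : (visits st ac n i a : ℝ) ≠ 0 := by positivity
      push_cast
      field_simp
      ring
  · have ht : transitions st ac (n + 1) i a j = transitions st ac n i a j := by
      rw [transitions_succ, if_neg fun hc => h ⟨hc.1, hc.2.1⟩, add_zero]
    rw [empProb, empProb, ht, visits_succ, empStep, if_neg h, if_neg h]
    simp

lemma tendsto_relaxSeq [Fintype S] [Fintype A] [Nonempty S] [Nonempty A] (M : MDP S A)
    {w₀ : ℝ} {α : ℕ → ℝ} (hα : ∀ n, α n ∈ Set.Icc (0 : ℝ) 1) (hα_sum : ¬ Summable α)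
    (hP : ∀ i a, Tendsto (fun n => empProb st ac n i a i) atTop (𝓝 (M.p i a i))) :
    Tendsto (relaxSeq M.γ w₀ α st ac) atTop (𝓝 M.wStar) := by
  set f : S × A → ℝ := fun x => M.p x.1 x.2 x.1 with hf
  obtain ⟨y, -, hy⟩ := Finset.exists_mem_eq_inf' (Finset.univ_nonempty (α := S × A)) f
  have hmin : Tendsto (fun n => Finset.univ.inf' Finset.univ_nonempty
      (fun x : S × A => empProb st ac n x.1 x.2 x.1)) atTop
      (𝓝 (Finset.univ.inf' Finset.univ_nonempty f)) :=
    Tendsto.finset_inf'_nhds_apply _ fun x _ => hP x.1 x.2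
  have hu : Tendsto (fun n => 1 / (1 - M.γ * Finset.univ.inf' Finset.univ_nonempty
      (fun x : S × A => empProb st ac n x.1 x.2 x.1)) - M.wStar) atTop (𝓝 0) := by
    have hne : 1 - M.γ * Finset.univ.inf' Finset.univ_nonempty f ≠ 0 := by
      rw [hy]; exact (M.one_sub_mul_pos (M.p_le_one _ _ _)).ne'
    have h1 := (tendsto_const_nhds (x := (1 : ℝ))).div ((hmin.const_mul M.γ).const_sub 1) hne
    rw [M.one_div_one_sub_inf'_eq_wStar] at h1
    simpa using h1.sub_const M.wStar
  have h0 := tendsto_zero_of_averaging (x := fun n => relaxSeq M.γ w₀ α st ac n - M.wStar)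
    (ν := fun _ => 0) (c := 0) hα hα_sum (by simp)
    (fun n => by simp only [relaxSeq]; ring) hu
  simpa using h0.add_const M.wStar

end Paths

/-! ### Measurability of the iterates -/

section Measurability

variable {S A Ω : Type*} {m : MeasurableSpace Ω}

/-- States and actions carry no σ-algebra; measurability in a random state or action is checked on
the finitely many pieces where it is constant. -/
lemma measurable_eval_of_fiber {ι : Type*} [Finite ι] {σ : Ω → ι}
    (hσ : ∀ s, MeasurableSet {ω | σ ω = s}) {F : ι → Ω → ℝ} (hF : ∀ s, Measurable (F s)) :
    Measurable fun ω => F (σ ω) ω := by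
  intro t ht
  have : (fun ω => F (σ ω) ω) ⁻¹' t = ⋃ s, {ω | σ ω = s} ∩ F s ⁻¹' t := by
    ext ω; simp
  rw [this]
  exact MeasurableSet.iUnion fun s => (hσ s).inter (hF s ht)

lemma measurable_sorTarget [Finite A] {am : (A → ℝ) → A} (ham : IsArgmaxRule am)
    {Qsel Qev : Ω → S → A → ℝ} {w : Ω → ℝ} (hsel : ∀ i a, Measurable fun ω => Qsel ω i a)
    (hev : ∀ i a, Measurable fun ω => Qev ω i a) (hw : Measurable w) (γ rew : ℝ) (i j : S) :
    Measurable fun ω => sorTarget am γ (w ω) rew (Qsel ω) (Qev ω) i j := by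
  have hrow : ∀ i, Measurable fun ω => Qev ω i (am (Qsel ω i)) := fun i =>
    measurable_eval_of_fiber (F := fun a ω => Qev ω i a)
      (fun a => (measurable_pi_lambda (fun ω => Qsel ω i) (hsel i)) (ham.measurable a)) (hev i)
  unfold sorTarget
  exact (hw.mul (((hrow j).const_mul γ).const_add rew)).add ((hw.const_sub 1).mul (hrow i))

end Measurability

/-! ### One-step recursion of each table entry -/

section Recursion

variable {S A : Type*} [DecidableEq S] [DecidableEq A] [Fintype S]

lemma mfDSORQL_succ_fst (M : MDP S A) (am : (A → ℝ) → A) (sel : Selector)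
    (QA₀ QB₀ : S → A → ℝ) (β : ℕ → S → A → ℝ) (w : ℕ → ℝ) (st : ℕ → S) (ac : ℕ → A)
    (coin : ℕ → Bool) (n : ℕ) (i : S) (a : A) :
    (mfDSORQL M am sel QA₀ QB₀ β w st ac coin (n + 1)).1 i a =
      let Q := mfDSORQL M am sel QA₀ QB₀ β w st ac coin n
      if coin n = true ∧ st n = i ∧ ac n = a then (1 - β n i a) * Q.1 i a + β n i a *
        sorTarget am M.γ (w n) (M.r i a (st (n + 1))) Q.1 Q.2 i (st (n + 1))
      else Q.1 i a := by
  simp only [mfDSORQL]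
  by_cases hc : coin n = true
  · by_cases h : st n = i ∧ ac n = a
    · obtain ⟨rfl, rfl⟩ := h
      simp [hc, relaxEntry]
    · have h' : ¬ (i = st n ∧ a = ac n) := fun hh => h ⟨hh.1.symm, hh.2.symm⟩
      simp [hc, relaxEntry, h, h']
  · simp [hc]

lemma mfDSORQL_succ_snd (M : MDP S A) (am : (A → ℝ) → A) (sel : Selector)
    (QA₀ QB₀ : S → A → ℝ) (β : ℕ → S → A → ℝ) (w : ℕ → ℝ) (st : ℕ → S) (ac : ℕ → A)
    (coin : ℕ → Bool) (n : ℕ) (i : S) (a : A) :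
    (mfDSORQL M am sel QA₀ QB₀ β w st ac coin (n + 1)).2 i a =
      let Q := mfDSORQL M am sel QA₀ QB₀ β w st ac coin n
      if coin n = false ∧ st n = i ∧ ac n = a then (1 - β n i a) * Q.2 i a + β n i a *
        sorTarget am M.γ (w n) (M.r i a (st (n + 1))) (sel.pick Q.1 Q.2) Q.1 i (st (n + 1))
      else Q.2 i a := by
  simp only [mfDSORQL]
  by_cases hc : coin n = true
  · simp [hc]
  · by_cases h : st n = i ∧ ac n = a
    · obtain ⟨rfl, rfl⟩ := h
      simp [hc, relaxEntry]
    · have h' : ¬ (i = st n ∧ a = ac n) := fun hh => h ⟨hh.1.symm, hh.2.symm⟩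
      simp [hc, relaxEntry, h, h']

end Recursion

/-! ### Adaptedness of the counts, step sizes, relaxation parameters and tables -/

namespace IsSampling

variable {S A Ω : Type*} [Fintype S] {mΩ : MeasurableSpace Ω}
  {M : MDP S A} {μ : Measure Ω} {𝒢 : Filtration ℕ mΩ} {QA₀ QB₀ : Ω → S → A → ℝ}
  {β : ℕ → Ω → S → A → ℝ} {st : ℕ → Ω → S} {ac : ℕ → Ω → A} {coin : ℕ → Ω → Bool}

lemma measurableSet_sampled (h : IsSampling M μ 𝒢 QA₀ QB₀ β st ac coin) (n : ℕ) (i : S) (a : A) :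
    MeasurableSet[𝒢 n] {ω | st n ω = i ∧ ac n ω = a} :=
  (h.state_meas n i).inter (h.action_meas n a)

variable [DecidableEq S] [DecidableEq A]

lemma measurable_visits (h : IsSampling M μ 𝒢 QA₀ QB₀ β st ac coin) (n : ℕ) (i : S) (a : A) :
    Measurable[𝒢 n] fun ω => (visits (fun k => st k ω) (fun k => ac k ω) n i a : ℝ) := by
  simp only [visits, Finset.card_filter, Nat.cast_sum]
  refine Finset.measurable_fun_sum _ fun k hk => ?_
  have hk := Finset.mem_range.1 hk
  simp only [Nat.cast_ite, Nat.cast_one, Nat.cast_zero]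
  exact Measurable.ite (𝒢.mono hk.le _ (h.measurableSet_sampled k i a)) measurable_const
    measurable_const

lemma measurable_transitions (h : IsSampling M μ 𝒢 QA₀ QB₀ β st ac coin) (n : ℕ) (i : S) (a : A)
    (j : S) : Measurable[𝒢 n] fun ω =>
      (transitions (fun k => st k ω) (fun k => ac k ω) n i a j : ℝ) := by
  simp only [transitions, Finset.card_filter, Nat.cast_sum]
  refine Finset.measurable_fun_sum _ fun k hk => ?_
  have hk := Finset.mem_range.1 hk
  simp only [Nat.cast_ite, Nat.cast_one, Nat.cast_zero]
  -- The last transition counted ends in state `n`, which is already known at time `n`: `k < n`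
  -- gives `k + 1 ≤ n`.
  exact Measurable.ite ((𝒢.mono hk.le _ (h.state_meas k i)).inter
    ((𝒢.mono hk.le _ (h.action_meas k a)).inter (𝒢.mono hk _ (h.state_meas (k + 1) j))))
    measurable_const measurable_const

lemma measurable_empStep (h : IsSampling M μ 𝒢 QA₀ QB₀ β st ac coin) (n : ℕ) (i : S) (a : A) :
    Measurable[𝒢 n] fun ω => empStep (fun k => st k ω) (fun k => ac k ω) i a n :=
  Measurable.ite (h.measurableSet_sampled n i a)
    (((h.measurable_visits n i a).add_const 1).const_div 1) measurable_const

lemma measurable_activeStep (h : IsSampling M μ 𝒢 QA₀ QB₀ β st ac coin) (n : ℕ) (i : S) (a : A) :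
    Measurable[𝒢 n] fun ω =>
      activeStep (fun k => st k ω) (fun k => ac k ω) (fun k => β k ω) i a n :=
  Measurable.ite (h.measurableSet_sampled n i a) (h.step_meas n i a) measurable_const

lemma measurable_relaxSeq [Fintype A] [Nonempty S] [Nonempty A]
    (h : IsSampling M μ 𝒢 QA₀ QB₀ β st ac coin) (γ w₀ : ℝ) (α : ℕ → ℝ) (n : ℕ) :
    Measurable[𝒢 n] fun ω => relaxSeq γ w₀ α (fun k => st k ω) (fun k => ac k ω) n := by
  induction n with
  | zero => exact measurable_const
  | succ n ih =>
    have hm : Measurable[𝒢 n] fun ω => Finset.univ.inf' Finset.univ_nonempty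
        (fun x : S × A => empProb (fun k => st k ω) (fun k => ac k ω) n x.1 x.2 x.1) := by
      have hinf : Measurable[𝒢 n] (Finset.univ.inf' Finset.univ_nonempty fun (x : S × A) ω =>
          empProb (fun k => st k ω) (fun k => ac k ω) n x.1 x.2 x.1) :=
        Finset.inf'_induction _ _ (p := fun f => Measurable[𝒢 n] f)
          (fun f hf g hg => hf.inf hg) fun x _ =>
            (h.measurable_transitions n x.1 x.2 x.1).div (h.measurable_visits n x.1 x.2)
      convert hinf using 1
      ext ω
      rw [Finset.inf'_apply]
    have h1 : Measurable[𝒢 n] fun ω =>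
        relaxSeq γ w₀ α (fun k => st k ω) (fun k => ac k ω) (n + 1) :=
      ih.add ((((((hm.const_mul γ).const_sub 1).const_div 1).sub ih)).const_mul (α n))
    exact h1.mono (𝒢.mono n.le_succ) le_rfl

lemma measurable_tables [Finite A] (h : IsSampling M μ 𝒢 QA₀ QB₀ β st ac coin)
    {am : (A → ℝ) → A} (ham : IsArgmaxRule am) (sel : Selector) {w : ℕ → Ω → ℝ}
    (hw : ∀ n, Measurable[𝒢 n] (w n)) {QA QB : ℕ → Ω → S → A → ℝ}
    (hQ : ∀ n ω, (QA n ω, QB n ω) =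
      mfDSORQL M am sel (QA₀ ω) (QB₀ ω) (fun k => β k ω) (fun k => w k ω)
        (fun k => st k ω) (fun k => ac k ω) (fun k => coin k ω) n) (n : ℕ) :
    (∀ i a, Measurable[𝒢 n] fun ω => QA n ω i a) ∧
      ∀ i a, Measurable[𝒢 n] fun ω => QB n ω i a := by
  induction n with
  | zero =>
    have hA : QA 0 = QA₀ := funext fun ω => congrArg Prod.fst (hQ 0 ω)
    have hB : QB 0 = QB₀ := funext fun ω => congrArg Prod.snd (hQ 0 ω)
    rw [hA, hB]
    exact ⟨h.initA_meas, h.initB_meas⟩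
  | succ n ih =>
    have hle : 𝒢 n ≤ 𝒢 (n + 1) := 𝒢.mono n.le_succ
    have hA : ∀ i a, Measurable[𝒢 (n + 1)] fun ω => QA n ω i a :=
      fun i a => (ih.1 i a).mono hle le_rfl
    have hB : ∀ i a, Measurable[𝒢 (n + 1)] fun ω => QB n ω i a :=
      fun i a => (ih.2 i a).mono hle le_rfl
    have hpick : ∀ i a, Measurable[𝒢 (n + 1)] fun ω => sel.pick (QA n ω) (QB n ω) i a := by
      cases sel
      · exact hA
      · exact hB
    have hwn : Measurable[𝒢 (n + 1)] (w n) := (hw n).mono hle le_rfl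
    have hβn : ∀ i a, Measurable[𝒢 (n + 1)] fun ω => β n ω i a :=
      fun i a => (h.step_meas n i a).mono hle le_rfl
    have hset : ∀ c i a, MeasurableSet[𝒢 (n + 1)] {ω | coin n ω = c ∧ st n ω = i ∧ ac n ω = a} :=
      fun c i a => (h.coin_meas n c).inter (hle _ (h.measurableSet_sampled n i a))
    refine ⟨fun i a => ?_, fun i a => ?_⟩
    · have he : (fun ω => QA (n + 1) ω i a) = fun ω =>
          if coin n ω = true ∧ st n ω = i ∧ ac n ω = a then (1 - β n ω i a) * QA n ω i a +
            β n ω i a * sorTarget am M.γ (w n ω) (M.r i a (st (n + 1) ω)) (QA n ω) (QB n ω) i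
              (st (n + 1) ω) else QA n ω i a := by
        ext ω
        have h1 := mfDSORQL_succ_fst M am sel (QA₀ ω) (QB₀ ω) (fun k => β k ω) (fun k => w k ω)
          (fun k => st k ω) (fun k => ac k ω) (fun k => coin k ω) n i a
        simpa only [← hQ] using h1
      rw [he]
      refine Measurable.ite (hset _ i a) ?_ (hA i a)
      refine (((hβn i a).const_sub 1).mul (hA i a)).add ((hβn i a).mul ?_)
      exact measurable_eval_of_fiber (h.state_meas (n + 1)) (F := fun j ω =>
        sorTarget am M.γ (w n ω) (M.r i a j) (QA n ω) (QB n ω) i j)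
        fun j => measurable_sorTarget ham hA hB hwn _ _ i j
    · have he : (fun ω => QB (n + 1) ω i a) = fun ω =>
          if coin n ω = false ∧ st n ω = i ∧ ac n ω = a then (1 - β n ω i a) * QB n ω i a +
            β n ω i a * sorTarget am M.γ (w n ω) (M.r i a (st (n + 1) ω))
              (sel.pick (QA n ω) (QB n ω)) (QA n ω) i (st (n + 1) ω) else QB n ω i a := by
        ext ω
        have h1 := mfDSORQL_succ_snd M am sel (QA₀ ω) (QB₀ ω) (fun k => β k ω) (fun k => w k ω)
          (fun k => st k ω) (fun k => ac k ω) (fun k => coin k ω) n i a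
        simpa only [← hQ] using h1
      rw [he]
      refine Measurable.ite (hset _ i a) ?_ (hB i a)
      refine (((hβn i a).const_sub 1).mul (hB i a)).add ((hβn i a).mul ?_)
      exact measurable_eval_of_fiber (h.state_meas (n + 1)) (F := fun j ω =>
        sorTarget am M.γ (w n ω) (M.r i a j) (sel.pick (QA n ω) (QB n ω)) (QA n ω) i j)
        fun j => measurable_sorTarget ham hpick hA hwn _ _ i j

end IsSampling

/-! ### The sampling noise -/

section Noise

variable {S A Ω : Type*} [Fintype S]

/-- The deviation of the event that the next state is `j` and the coin shows `c` from its conditional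
probability. -/
noncomputable def sampleNoise (M : MDP S A) (st : ℕ → Ω → S) (ac : ℕ → Ω → A)
    (coin : ℕ → Ω → Bool) (j : S) (c : Bool) (n : ℕ) (ω : Ω) : ℝ :=
  Set.indicator {ω | st (n + 1) ω = j ∧ coin n ω = c} (fun _ => (1 : ℝ)) ω -
    M.p (st n ω) (ac n ω) j * (1 / 2)

variable {M : MDP S A} {st : ℕ → Ω → S} {ac : ℕ → Ω → A} {coin : ℕ → Ω → Bool}

lemma abs_sampleNoise_le_one (j : S) (c : Bool) (n : ℕ) (ω : Ω) :
    |sampleNoise M st ac coin j c n ω| ≤ 1 := by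
  have h1 := M.p_nonneg (st n ω) (ac n ω) j
  have h2 := M.p_le_one (st n ω) (ac n ω) j
  rw [sampleNoise, abs_le]
  by_cases h : ω ∈ {ω | st (n + 1) ω = j ∧ coin n ω = c}
  · rw [Set.indicator_of_mem h]
    constructor <;> linarith
  · rw [Set.indicator_of_notMem h]
    constructor <;> linarith

lemma sampleNoise_true_add_false [DecidableEq S] (j : S) (n : ℕ) (ω : Ω) :
    sampleNoise M st ac coin j true n ω + sampleNoise M st ac coin j false n ω =
      (if st (n + 1) ω = j then 1 else 0) - M.p (st n ω) (ac n ω) j := by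
  simp only [sampleNoise, Set.indicator_apply, Set.mem_ofPred_eq]
  rcases Bool.eq_false_or_eq_true (coin n ω) with hc | hc <;>
    by_cases h : st (n + 1) ω = j <;> simp [h, hc] <;> ring

/-- One update of an entry, split into its conditional mean and the sampling noise. -/
lemma update_eq_mean_add_noise [DecidableEq S] [DecidableEq A] (β : ℕ → S → A → ℝ) (c : Bool)
    (T : S → ℝ) (q : ℝ) (i : S) (a : A) (n : ℕ) (ω : Ω) :
    (if coin n ω = c ∧ st n ω = i ∧ ac n ω = a then
        (1 - β n i a) * q + β n i a * T (st (n + 1) ω) else q) =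
      (1 - activeStep (fun k => st k ω) (fun k => ac k ω) β i a n / 2) * q +
      activeStep (fun k => st k ω) (fun k => ac k ω) β i a n / 2 * ∑ j, M.p i a j * T j +
      ∑ j, activeStep (fun k => st k ω) (fun k => ac k ω) β i a n * (T j - q) *
        sampleNoise M st ac coin j c n ω := by
  by_cases h : st n ω = i ∧ ac n ω = a
  · obtain ⟨rfl, rfl⟩ := h
    -- The update adds `β (T j - q)` on the event that the next state is `j` and the coin shows `c`.
    -- Subtracting the conditional probability `p j / 2` of this event produces the halved step
    -- size.
    have h1 : ∀ j, β n (st n ω) (ac n ω) * (T j - q) * sampleNoise M st ac coin j c n ω =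
        (if st (n + 1) ω = j then
          (if coin n ω = c then β n (st n ω) (ac n ω) * (T j - q) else 0) else 0) -
        β n (st n ω) (ac n ω) / 2 * (M.p (st n ω) (ac n ω) j * T j) +
        β n (st n ω) (ac n ω) / 2 * q * M.p (st n ω) (ac n ω) j := fun j => by
      simp only [sampleNoise, Set.indicator_apply, Set.mem_ofPred_eq]
      by_cases hj : st (n + 1) ω = j <;> by_cases hc : coin n ω = c <;> simp [hj, hc] <;> ring
    simp only [activeStep, and_self, and_true, if_true, h1, Finset.sum_add_distrib,
      Finset.sum_sub_distrib, Finset.sum_ite_eq, Finset.mem_univ, ← Finset.mul_sum, M.p_sum]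
    split_ifs <;> ring
  · simp [activeStep, h]

end Noise

/-! ### Almost sure convergence of the noise series -/

namespace IsSampling

variable {S A Ω : Type*} [Fintype S] {mΩ : MeasurableSpace Ω}
  {M : MDP S A} {μ : Measure Ω} [IsProbabilityMeasure μ] {𝒢 : Filtration ℕ mΩ}
  {QA₀ QB₀ : Ω → S → A → ℝ} {β : ℕ → Ω → S → A → ℝ} {st : ℕ → Ω → S} {ac : ℕ → Ω → A}
  {coin : ℕ → Ω → Bool}

lemma ae_tendsto_sum_mul_sampleNoise [Finite A] (h : IsSampling M μ 𝒢 QA₀ QB₀ β st ac coin)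
    {g : ℕ → Ω → ℝ} (hg : ∀ n, Measurable[𝒢 n] (g n))
    (hsq : ∀ᵐ ω ∂μ, Summable fun n => g n ω ^ 2) (j : S) (c : Bool) :
    ∀ᵐ ω ∂μ, ∃ l, Tendsto (fun n => ∑ k ∈ Finset.range n,
      g k ω * sampleNoise M st ac coin j c k ω) atTop (𝓝 l) := by
  have hE : ∀ n, MeasurableSet[𝒢 (n + 1)] {ω | st (n + 1) ω = j ∧ coin n ω = c} := fun n =>
    (h.state_meas (n + 1) j).inter (h.coin_meas n c)
  have hπ : ∀ n, Measurable[𝒢 n] fun ω => M.p (st n ω) (ac n ω) j * (1 / 2) := fun n => by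
    refine Measurable.mul_const ?_ _
    refine measurable_eval_of_fiber (h.state_meas n) (F := fun i ω => M.p i (ac n ω) j)
      fun i => ?_
    exact measurable_eval_of_fiber (h.action_meas n) (F := fun a _ => M.p i a j)
      fun a => measurable_const
  refine ae_tendsto_sum_of_summable_sq (fun n => (hg n).stronglyMeasurable) (fun n => ?_)
    (fun n ω => abs_sampleNoise_le_one j c n ω) (fun n => ?_) hsq
  · exact ((measurable_const.indicator (hE n)).sub
      ((hπ n).mono (𝒢.mono n.le_succ) le_rfl)).stronglyMeasurable
  · have hi1 : Integrable (Set.indicator {ω | st (n + 1) ω = j ∧ coin n ω = c}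
        (fun _ => (1 : ℝ))) μ := (integrable_const 1).indicator (𝒢.le _ _ (hE n))
    have hi2 : Integrable (fun ω => M.p (st n ω) (ac n ω) j * (1 / 2)) μ :=
      Integrable.of_bound ((hπ n).mono (𝒢.le n) le_rfl).aestronglyMeasurable 1
        (ae_of_all _ fun ω => by
          have h1 := M.p_nonneg (st n ω) (ac n ω) j
          have h2 := M.p_le_one (st n ω) (ac n ω) j
          rw [Real.norm_eq_abs, abs_of_nonneg (by positivity)]
          linarith)
    have h1 := condExp_sub hi1 hi2 (𝒢 n)
    rw [condExp_of_stronglyMeasurable (𝒢.le n) (hπ n).stronglyMeasurable hi2] at h1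
    filter_upwards [h1, h.law n j c] with ω h2 h3
    refine h2.trans ?_
    rw [Pi.sub_apply, h3]
    simp

lemma ae_tendsto_empProb [Finite A] [DecidableEq S] [DecidableEq A]
    (h : IsSampling M μ 𝒢 QA₀ QB₀ β st ac coin)
    (hvisit : ∀ᵐ ω ∂μ, ∀ i a, ∃ᶠ n in atTop, st n ω = i ∧ ac n ω = a) (i : S) (a : A) (j : S) :
    ∀ᵐ ω ∂μ, Tendsto (fun n => empProb (fun k => st k ω) (fun k => ac k ω) n i a j) atTop
      (𝓝 (M.p i a j)) := by
  have hc := h.ae_tendsto_sum_mul_sampleNoise (fun n => h.measurable_empStep n i a)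
    (ae_of_all _ fun ω => summable_empStep_sq i a) j
  filter_upwards [hc true, hc false, hvisit] with ω h1 h2 h3
  obtain ⟨l₁, h1⟩ := h1
  obtain ⟨l₂, h2⟩ := h2
  have hν := h1.add h2
  -- Adding the two coin outcomes leaves the noise of the next state alone, which drives the
  -- empirical frequency.
  simp only [← Finset.sum_add_distrib, ← mul_add, sampleNoise_true_add_false] at hν
  have h0 := tendsto_zero_of_averaging (G := fun _ => 0)
    (x := fun n => empProb (fun k => st k ω) (fun k => ac k ω) n i a j - M.p i a j)
    (empStep_mem_Icc i a) (not_summable_empStep (h3 i a)) hν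
    (fun n => by
      rw [empProb_succ]
      by_cases hs : st n ω = i ∧ ac n ω = a
      · rw [hs.1, hs.2]; ring
      · simp [empStep, hs])
    tendsto_const_nhds
  simpa using h0.add_const (M.p i a j)

lemma ae_tendsto_update_noise [Finite A] [DecidableEq S] [DecidableEq A]
    (h : IsSampling M μ 𝒢 QA₀ QB₀ β st ac coin) {f : ℕ → S → Ω → ℝ}
    (hf : ∀ n j, Measurable[𝒢 n] (f n j)) (hfb : ∀ᵐ ω ∂μ, ∃ K, ∀ n j, |f n j ω| ≤ K)
    (i : S) (a : A) (hsq : ∀ᵐ ω ∂μ, Summable fun n =>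
      activeStep (fun k => st k ω) (fun k => ac k ω) (fun k => β k ω) i a n ^ 2) (c : Bool) :
    ∀ᵐ ω ∂μ, ∃ l, Tendsto (fun n => ∑ k ∈ Finset.range n, ∑ j,
      activeStep (fun k => st k ω) (fun k => ac k ω) (fun k => β k ω) i a k * f k j ω *
        sampleNoise M st ac coin j c k ω) atTop (𝓝 l) := by
  have hj := fun j => h.ae_tendsto_sum_mul_sampleNoise
    (fun n => (h.measurable_activeStep n i a).mul (hf n j)) (by
      filter_upwards [hfb, hsq] with ω ⟨K, hK⟩ hs
      refine Summable.of_nonneg_of_le (fun _ => sq_nonneg _) (fun n => ?_) (hs.mul_right (K ^ 2))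
      simp only [Pi.mul_apply, mul_pow]
      exact mul_le_mul_of_nonneg_left (sq_le_sq' (abs_le.1 (hK n j)).1 (abs_le.1 (hK n j)).2)
        (sq_nonneg _)) j c
  filter_upwards [ae_all_iff.2 hj] with ω hω
  choose l hl using hω
  refine ⟨∑ j, l j, ?_⟩
  -- There are finitely many next states, so the series converges as a finite sum of convergent
  -- series.
  simp_rw [Finset.sum_comm (s := Finset.range _)]
  exact tendsto_finsetSum _ fun j _ => hl j

end IsSampling

/-! ### Convergence of the two tables -/

lemma abs_sorTarget_le {S A : Type*} {am : (A → ℝ) → A} {γ w rew W R B : ℝ}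
    {Qsel Qev : S → A → ℝ} (hγ0 : 0 ≤ γ) (hγ1 : γ ≤ 1) (hw : |w| ≤ W) (hr : |rew| ≤ R)
    (hB : ∀ i a, |Qev i a| ≤ B) (i j : S) :
    |sorTarget am γ w rew Qsel Qev i j| ≤ W * (R + B) + (1 + W) * B := by
  have hB0 : 0 ≤ B := (abs_nonneg _).trans (hB i (am (Qsel i)))
  have h1 : |γ * Qev j (am (Qsel j))| ≤ B := by
    rw [abs_mul, abs_of_nonneg hγ0]
    exact (mul_le_of_le_one_left (abs_nonneg _) hγ1).trans (hB _ _)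
  have h2 : |rew + γ * Qev j (am (Qsel j))| ≤ R + B := (abs_add_le _ _).trans (add_le_add hr h1)
  have h3 : |1 - w| ≤ 1 + W := (abs_sub _ _).trans (by rw [abs_one]; linarith)
  rw [sorTarget]
  refine (abs_add_le _ _).trans (add_le_add ?_ ?_)
  · rw [abs_mul]
    exact mul_le_mul hw h2 (abs_nonneg _) ((abs_nonneg _).trans hw)
  · rw [abs_mul]
    exact mul_le_mul h3 (hB _ _) (abs_nonneg _) ((abs_nonneg _).trans h3)

/-- Pathwise convergence of double relaxed Q-learning, given convergence of the relaxation
parameters and of the noise series. -/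
lemma tendsto_tables_of_noise {S A : Type*} [Fintype S] [Fintype A] [Nonempty S] [Nonempty A]
    (M : MDP S A) {am : (A → ℝ) → A} (ham : IsArgmaxRule am) (sel : Selector)
    {QA QB b νA νB : ℕ → S → A → ℝ} {w : ℕ → ℝ} {B : ℝ} {Qstar : S → A → ℝ}
    (hstar : Function.IsFixedPt (M.sorOp M.wStar) Qstar)
    (hB : ∀ n i a, |QA n i a| ≤ B ∧ |QB n i a| ≤ B) (hw : Tendsto w atTop (𝓝 M.wStar))
    (hb : ∀ n i a, b n i a ∈ Set.Icc (0 : ℝ) 1) (hb_sum : ∀ i a, ¬ Summable fun n => b n i a)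
    (hνA : ∀ i a, ∃ l, Tendsto (fun n => ∑ k ∈ Finset.range n, νA k i a) atTop (𝓝 l))
    (hνB : ∀ i a, ∃ l, Tendsto (fun n => ∑ k ∈ Finset.range n, νB k i a) atTop (𝓝 l))
    (hA : ∀ n i a, QA (n + 1) i a = (1 - b n i a) * QA n i a +
      b n i a * M.sorMean (w n) (fun j => QB n j (am (QA n j))) i a + νA n i a)
    (hB' : ∀ n i a, QB (n + 1) i a = (1 - b n i a) * QB n i a +
      b n i a * M.sorMean (w n) (fun j => QA n j (am (sel.pick (QA n) (QB n) j))) i a +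
        νB n i a) (i : S) (a : A) :
    Tendsto (fun n => QA n i a) atTop (𝓝 (Qstar i a)) ∧
      Tendsto (fun n => QB n i a) atTop (𝓝 (Qstar i a)) := by
  set R : ℝ := ∑ x : S × A, |M.meanReward x.1 x.2| with hRdef
  have hR : ∀ i a, |M.meanReward i a| ≤ R := fun i a =>
    Finset.single_le_sum (f := fun x : S × A => |M.meanReward x.1 x.2|)
      (fun _ _ => abs_nonneg _) (Finset.mem_univ (i, a))
  set η : ℕ → ℝ := fun n => |w n - M.wStar| * (R + 2 * B) with hηdef
  have hη : Tendsto η atTop (𝓝 0) := by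
    have h1 : Tendsto (fun n => w n - M.wStar) atTop (𝓝 0) := by
      simpa using hw.sub_const M.wStar
    simpa using h1.abs.mul_const (R + 2 * B)
  -- The gap between the tables contracts by itself, independently of where the tables go. The error
  -- `η n + η n` pays for replacing `w n` by `w*` in both targets.
  have hD : ∀ x : S × A, Tendsto (fun n => QA n x.1 x.2 - QB n x.1 x.2) atTop (𝓝 0) := by
    refine tendsto_zero_of_contraction_of_noise
      (x := fun n (x : S × A) => QA n x.1 x.2 - QB n x.1 x.2) (b := fun n x => b n x.1 x.2)
      (G := fun n x => M.sorMean (w n) (fun j => QB n j (am (QA n j))) x.1 x.2 -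
        M.sorMean (w n) (fun j => QA n j (am (sel.pick (QA n) (QB n) j))) x.1 x.2)
      (ν := fun n x => νA n x.1 x.2 - νB n x.1 x.2) (ε := fun n => η n + η n) (B := B + B)
      M.sorFactor_nonneg M.sorFactor_lt_one (fun n x => hb n x.1 x.2)
      (fun x => hb_sum x.1 x.2)
      (fun n x => (abs_sub _ _).trans (add_le_add (hB n _ _).1 (hB n _ _).2))
      (fun x => ?_) (fun n x => by simp only [hA, hB']; ring) (fun n C hC x => ?_)
      (by simpa using hη.add hη)
    · obtain ⟨l, hl⟩ := hνA x.1 x.2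
      obtain ⟨l', hl'⟩ := hνB x.1 x.2
      refine ⟨l - l', ?_⟩
      simpa only [Finset.sum_sub_distrib] using hl.sub hl'
    · have h1 := abs_le.1 (M.abs_sorMean_sub_sorMean_relax_le (w := w n) (w' := M.wStar)
        (fun j => (hB n j (am (QA n j))).2) x.1 x.2 (hR x.1 x.2))
      have h2 := abs_le.1 (M.abs_sorMean_sub_sorMean_relax_le (w := w n) (w' := M.wStar)
        (fun j => (hB n j (am (sel.pick (QA n) (QB n) j))).1) x.1 x.2 (hR x.1 x.2))
      have h3 := abs_le.1 (M.abs_sorMean_sub_sorMean_le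
        (abs_cross_eval_sub_le ham sel fun i a => hC (i, a)) x.1 x.2)
      simp only [hηdef]
      rw [abs_le]
      constructor <;> linarith [h1.1, h1.2, h2.1, h2.2, h3.1, h3.2]
  set d : ℕ → ℝ := fun n => ∑ x : S × A, |QA n x.1 x.2 - QB n x.1 x.2| with hddef
  have hd : Tendsto d atTop (𝓝 0) := by
    simpa using tendsto_finsetSum Finset.univ fun x _ => (hD x).abs
  have hDd : ∀ n i a, |QA n i a - QB n i a| ≤ d n := fun n i a =>
    Finset.single_le_sum (f := fun x : S × A => |QA n x.1 x.2 - QB n x.1 x.2|)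
      (fun _ _ => abs_nonneg _) (Finset.mem_univ (i, a))
  have hfix : ∀ i a, M.sorMean M.wStar (maxOp Qstar) i a = Qstar i a := fun i a =>
    congrFun (congrFun hstar i) a
  set K : ℝ := ∑ x : S × A, |Qstar x.1 x.2| with hKdef
  have hE : ∀ x : S × A, Tendsto (fun n => QA n x.1 x.2 - Qstar x.1 x.2) atTop (𝓝 0) := by
    refine tendsto_zero_of_contraction_of_noise
      (x := fun n (x : S × A) => QA n x.1 x.2 - Qstar x.1 x.2) (b := fun n x => b n x.1 x.2)
      (G := fun n x => M.sorMean (w n) (fun j => QB n j (am (QA n j))) x.1 x.2 - Qstar x.1 x.2)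
      (ν := fun n x => νA n x.1 x.2) (ε := fun n => M.sorFactor * d n + η n) (B := B + K)
      M.sorFactor_nonneg M.sorFactor_lt_one (fun n x => hb n x.1 x.2)
      (fun x => hb_sum x.1 x.2)
      (fun n x => (abs_sub _ _).trans (add_le_add (hB n _ _).1 ?_))
      (fun x => hνA x.1 x.2) (fun n x => by simp only [hA]; ring) (fun n C hC x => ?_)
      (by simpa using (hd.const_mul M.sorFactor).add hη)
    · exact Finset.single_le_sum (f := fun x : S × A => |Qstar x.1 x.2|)
        (fun _ _ => abs_nonneg _) (Finset.mem_univ x)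
    · have h1 := abs_le.1 (M.abs_sorMean_sub_sorMean_relax_le (w := w n) (w' := M.wStar)
        (fun j => (hB n j (am (QA n j))).2) x.1 x.2 (hR x.1 x.2))
      -- `Q^B` at the action selected by `Q^A` is within `d n` of `max Q^A`, which is within `C` of
      -- `max Q*`.
      have hv : ∀ j, |QB n j (am (QA n j)) - maxOp Qstar j| ≤ C + d n := fun j => by
        have h2 := abs_le.1 (hDd n j (am (QA n j)))
        have h3 := abs_le.1 (abs_maxOp_sub_maxOp_le (fun i a => hC (i, a)) j)
        rw [maxOp_eq_apply_argmax ham (QA n)] at h3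
        rw [abs_le]
        constructor <;> linarith [h2.1, h2.2, h3.1, h3.2]
      have h4 := abs_le.1 (M.abs_sorMean_sub_sorMean_le hv x.1 x.2)
      rw [hfix] at h4
      simp only [hηdef]
      rw [abs_le]
      constructor <;> linarith [h1.1, h1.2, h4.1, h4.2]
  have hQA : Tendsto (fun n => QA n i a) atTop (𝓝 (Qstar i a)) := by
    simpa using (hE (i, a)).add_const (Qstar i a)
  exact ⟨hQA, by simpa using hQA.sub (hD (i, a))⟩

theorem mainTheorem3 {S A Ω : Type*} [Fintype S] [Fintype A] [Nonempty S] [Nonempty A]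
    [DecidableEq S] [DecidableEq A] {mΩ : MeasurableSpace Ω}
    (μ : Measure Ω) [IsProbabilityMeasure μ] (M : MDP S A)
    (am : (A → ℝ) → A) (ham : IsArgmaxRule am) (sel : Selector)
    -- the sampled data
    (𝒢 : Filtration ℕ mΩ) (QA₀ QB₀ : Ω → S → A → ℝ) (β : ℕ → Ω → S → A → ℝ)
    (st : ℕ → Ω → S) (ac : ℕ → Ω → A) (coin : ℕ → Ω → Bool)
    (hsamp : IsSampling M μ 𝒢 QA₀ QB₀ β st ac coin)
    -- the adaptive relaxation parameters `w n ω`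
    (w₀ : ℝ) (hw₀ : w₀ ∈ Set.Icc 1 (1 / (1 - M.γ)))
    (α : ℕ → ℝ) (hα : ∀ n, α n ∈ Set.Icc (0 : ℝ) 1)
    (hα_sum : ¬ Summable α) (hα_sq : Summable (fun n => α n ^ 2))
    (w : ℕ → Ω → ℝ)
    (hw : ∀ n ω, w n ω = relaxSeq M.γ w₀ α (fun k => st k ω) (fun k => ac k ω) n)
    -- the two tables
    (QA QB : ℕ → Ω → S → A → ℝ)
    (hQ : ∀ n ω, (QA n ω, QB n ω) =
      mfDSORQL M am sel (QA₀ ω) (QB₀ ω) (fun k => β k ω) (fun k => w k ω)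
        (fun k => st k ω) (fun k => ac k ω) (fun k => coin k ω) n)
    -- boundedness of both tables
    (hbdd : ∀ᵐ ω ∂μ, ∃ B : ℝ, ∀ n i a, |QA n ω i a| ≤ B ∧ |QB n ω i a| ≤ B)
    -- every pair is sampled infinitely often
    (hvisit : ∀ᵐ ω ∂μ, ∀ i a, ∃ᶠ n in atTop, st n ω = i ∧ ac n ω = a)
    -- Robbins–Monro step sizes
    (hβ : ∀ᵐ ω ∂μ, ∀ n i a, β n ω i a ∈ Set.Icc (0 : ℝ) 1)
    (hβ_sum : ∀ᵐ ω ∂μ, ∀ i a,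
      ¬ Summable (activeStep (fun k => st k ω) (fun k => ac k ω) (fun k => β k ω) i a))
    (hβ_sq : ∀ᵐ ω ∂μ, ∀ i a, Summable (fun n =>
      activeStep (fun k => st k ω) (fun k => ac k ω) (fun k => β k ω) i a n ^ 2)) :
    ∃ Qstar : S → A → ℝ,
      Function.IsFixedPt (M.sorOp M.wStar) Qstar ∧
      (∀ Q, Function.IsFixedPt (M.sorOp M.wStar) Q → Q = Qstar) ∧
      ∀ᵐ ω ∂μ, ∀ i a,
        Tendsto (fun n => QA n ω i a) atTop (𝓝 (Qstar i a)) ∧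
        Tendsto (fun n => QB n ω i a) atTop (𝓝 (Qstar i a)) := by
  obtain ⟨Qstar, hfix, huniq⟩ := M.exists_unique_fixedPt_sorOp
  refine ⟨Qstar, hfix, huniq, ?_⟩
  have hw_meas : ∀ n, Measurable[𝒢 n] (w n) := fun n => by
    rw [show w n = _ from funext (hw n)]
    exact hsamp.measurable_relaxSeq M.γ w₀ α n
  have hQ_meas := hsamp.measurable_tables ham sel hw_meas hQ
  have hpick : ∀ n i a, Measurable[𝒢 n] fun ω => sel.pick (QA n ω) (QB n ω) i a := fun n => by
    cases sel
    · exact (hQ_meas n).1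
    · exact (hQ_meas n).2
  have hw_lim : ∀ᵐ ω ∂μ, Tendsto (fun n => w n ω) atTop (𝓝 M.wStar) := by
    filter_upwards [ae_all_iff.2 fun i => ae_all_iff.2 fun a =>
      hsamp.ae_tendsto_empProb hvisit i a i] with ω hω
    simp only [hw]
    exact tendsto_relaxSeq M hα hα_sum hω
  have hsq : ∀ i a, ∀ᵐ ω ∂μ, Summable fun n =>
      activeStep (fun k => st k ω) (fun k => ac k ω) (fun k => β k ω) i a n ^ 2 :=
    fun i a => hβ_sq.mono fun ω hω => hω i a
  have hTb : ∀ᵐ ω ∂μ, ∃ K, ∀ n i a j,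
      |sorTarget am M.γ (w n ω) (M.r i a j) (QA n ω) (QB n ω) i j - QA n ω i a| ≤ K ∧
      |sorTarget am M.γ (w n ω) (M.r i a j) (sel.pick (QA n ω) (QB n ω)) (QA n ω) i j -
        QB n ω i a| ≤ K := by
    filter_upwards [hw_lim, hbdd] with ω hlim ⟨B, hB⟩
    -- Convergence of `w n ω` already bounds it along the path; a path-dependent bound suffices for
    -- square summability of the noise coefficients.
    obtain ⟨W, hW⟩ := hlim.abs.bddAbove_range
    have hW : ∀ n, |w n ω| ≤ W := fun n => hW ⟨n, rfl⟩
    have hR : ∀ i a j, |M.r i a j| ≤ ∑ x : S × A × S, |M.r x.1 x.2.1 x.2.2| := fun i a j =>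
      Finset.single_le_sum (f := fun x : S × A × S => |M.r x.1 x.2.1 x.2.2|)
        (fun _ _ => abs_nonneg _) (Finset.mem_univ (i, a, j))
    refine ⟨_, fun n i a j => ⟨(abs_sub _ _).trans (add_le_add (abs_sorTarget_le M.γ_nonneg
      M.γ_lt_one.le (hW n) (hR i a j) (fun i a => (hB n i a).2) i j) (hB n i a).1),
      (abs_sub _ _).trans (add_le_add (abs_sorTarget_le M.γ_nonneg
      M.γ_lt_one.le (hW n) (hR i a j) (fun i a => (hB n i a).1) i j) (hB n i a).2)⟩⟩
  have hnoiseA := ae_all_iff.2 fun i => ae_all_iff.2 fun a => hsamp.ae_tendsto_update_noise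
    (f := fun n j ω => sorTarget am M.γ (w n ω) (M.r i a j) (QA n ω) (QB n ω) i j - QA n ω i a)
    (fun n j => (measurable_sorTarget ham (hQ_meas n).1 (hQ_meas n).2 (hw_meas n) _ _ i j).sub
      ((hQ_meas n).1 i a))
    (hTb.mono fun ω ⟨K, hK⟩ => ⟨K, fun n j => (hK n i a j).1⟩) i a (hsq i a) true
  have hnoiseB := ae_all_iff.2 fun i => ae_all_iff.2 fun a => hsamp.ae_tendsto_update_noise
    (f := fun n j ω => sorTarget am M.γ (w n ω) (M.r i a j) (sel.pick (QA n ω) (QB n ω))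
      (QA n ω) i j - QB n ω i a)
    (fun n j => (measurable_sorTarget ham (hpick n) (hQ_meas n).1 (hw_meas n) _ _ i j).sub
      ((hQ_meas n).2 i a))
    (hTb.mono fun ω ⟨K, hK⟩ => ⟨K, fun n j => (hK n i a j).2⟩) i a (hsq i a) false
  filter_upwards [hbdd, hβ, hβ_sum, hw_lim, hnoiseA, hnoiseB]
    with ω ⟨B, hB⟩ hβω hsum hlim hνA hνB
  refine tendsto_tables_of_noise M ham sel (QA := fun n => QA n ω) (QB := fun n => QB n ω)
    (b := fun n i a => activeStep (fun k => st k ω) (fun k => ac k ω) (fun k => β k ω) i a n / 2)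
    hfix hB hlim (fun n i a => ?_) (fun i a hs => hsum i a ?_) hνA hνB
    (fun n i a => ?_) (fun n i a => ?_)
  · simp only [activeStep]
    have := hβω n i a
    split_ifs
    · exact ⟨by linarith [this.1], by linarith [this.2]⟩
    · simp
  · simpa using hs.mul_right 2
  · have h1 := mfDSORQL_succ_fst M am sel (QA₀ ω) (QB₀ ω) (fun k => β k ω) (fun k => w k ω)
      (fun k => st k ω) (fun k => ac k ω) (fun k => coin k ω) n i a
    simp only [← hQ] at h1
    rw [h1, M.sorMean_eq_sum]
    exact update_eq_mean_add_noise (fun k => β k ω) true (fun j =>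
      sorTarget am M.γ (w n ω) (M.r i a j) (QA n ω) (QB n ω) i j) (QA n ω i a) i a n ω
  · have h1 := mfDSORQL_succ_snd M am sel (QA₀ ω) (QB₀ ω) (fun k => β k ω) (fun k => w k ω)
      (fun k => st k ω) (fun k => ac k ω) (fun k => coin k ω) n i a
    simp only [← hQ] at h1
    rw [h1, M.sorMean_eq_sum]
    exact update_eq_mean_add_noise (fun k => β k ω) false (fun j =>
      sorTarget am M.γ (w n ω) (M.r i a j) (sel.pick (QA n ω) (QB n ω)) (QA n ω) i j)
      (QB n ω i a) i a n ω
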